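/- Let $\mathcal{C}=(\mathcal{C},\otimes,c,[-,-])$ be a closed symmetric monoidal category whose underlying category is finitely complete and finitely cocomplete, and let $\mathfrak{b}=(b,u_b,m_b)$, $\mathfrak{b}'=(b',u_{b'},m_{b'})$ be monoids in $\mathcal{C}$. Write $\mathrm{Mod}_{\mathfrak{b}}$ for the $\mathcal{C}$-enriched category of right $\mathfrak{b}$-modules $z_{\mathfrak b}=(z,\gamma_z:z\otimes b\to z)$, with Hom object $\mathrm{Mod}_{\mathfrak{b}}(z,\tilde z)$ the equalizer of $(\gamma_z)^{\star}$ and $(\gamma_{\tilde z})_{\star}\circ(-\otimes b)_{z,\tilde z}$ from $[z,\tilde z]$ to $[z\otimes b,\tilde z]$. It is tensored, with $w\circledast z_{\mathfrak b}=(w\otimes z,\ \mathrm{id}_w\otimes\gamma_z)$ for $w\in\mathcal{C}$. For an object $X$ of a $\mathcal{C}$-enriched category $\mathcal{D}$, $\mathrm{End}_{\mathcal{D}}(X)$ denotes the monoid $\mathcal{D}(X,X)$ in $\mathcal{C}$, with product the composition $(g,f)\mapsto g\circ f$. If $\mathcal{D}$ is tensored, $X$ is a $\mathcal{C}$-enriched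 compact generator of $\mathcal{D}$ if the enriched functor $\mathcal{D}(X,-):\mathcal{D}\to\mathcal{C}$ is conservative (its underlying functor reflects isomorphisms), preserves $\mathcal{C}$-tensors (the tensorial strength $z\otimes\mathcal{D}(X,Y)\to\mathcal{D}(X,z\circledast Y)$ is an isomorphism for all $z\in\mathcal{C}$, $Y\in\mathcal{D}$), and its underlying functor preserves coequalizers. A $(\mathfrak{b},\mathfrak{b}')$-bimodule is an object $x$ of $\mathcal{C}$ with commuting left $\mathfrak{b}$- and right $\mathfrak{b}'$-actions; ${}_{\mathfrak b}b_{\mathfrak b}$ is $b$ with both actions given by $m_b$. For a $(\mathfrak{b},\mathfrak{b}')$-bimodule $x$ and a $(\mathfrak{b}',\mathfrak{b}'')$-bimodule $y$, where $\mathfrak{b}''$ is a further monoid in $\mathcal{C}$, $x\circledast_{\mathfrak{b}'}y$ is the coequalizer of the two maps $x\otimes b'\otimes y\rightrightarrows x\otimes y$ given by the actions of $\mathfrak{b}'$, with the induced structure of a $(\mathfrak{b},\mathfrak{b}'')$-bimodule. Then the following are equivalent: (i) $\mathfrak{b}$ and $\mathfrak{b}'$ are Morita equivalent, i.e. $\mathrm{Mod}_{\mathfrak{b}}$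 and $\mathrm{Mod}_{\mathfrak{b}'}$ are equivalent as $\mathcal{C}$-enriched categories (there are $\mathcal{C}$-enriched functors in both directions whose two composites are $\mathcal{C}$-naturally isomorphic to the identities); (ii) there exist a $\mathcal{C}$-enriched compact generator $x_{\mathfrak{b}'}$ of $\mathrm{Mod}_{\mathfrak{b}'}$ and an isomorphism of monoids $\mathfrak{b}\cong\mathrm{End}_{\mathrm{Mod}_{\mathfrak{b}'}}(x_{\mathfrak{b}'})$ in $\mathcal{C}$; (iii) there exist a $(\mathfrak{b},\mathfrak{b}')$-bimodule ${}_{\mathfrak b}x_{\mathfrak b'}$ and a $(\mathfrak{b}',\mathfrak{b})$-bimodule ${}_{\mathfrak b'}y_{\mathfrak b}$ together with isomorphisms of bimodules ${}_{\mathfrak b}x_{\mathfrak b'}\circledast_{\mathfrak{b}'}{}_{\mathfrak b'}y_{\mathfrak b}\cong{}_{\mathfrak b}b_{\mathfrak b}$ and ${}_{\mathfrak b'}y_{\mathfrak b}\circledast_{\mathfrak{b}}{}_{\mathfrak b}x_{\mathfrak b'}\cong{}_{\mathfrak b'}b'_{\mathfrak b'}$. -/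

import Mathlib

open CategoryTheory MonoidalCategory Limits

universe v u w₁ w₂

namespace EnrichedMorita

noncomputable section

/-! ### Equivalences of enriched categories

Composition in a `V`-enriched category is written in diagrammatic order,
`eComp : Hom X Y ⊗ Hom Y Z ⟶ Hom X Z`.  The underlying (ordinary) category of `D` is
`ForgetEnrichment V D`, with morphisms `𝟙_ V ⟶ Hom X Y`. -/

section Equivalence

variable (V : Type u) [Category.{v} V] [MonoidalCategory V]

/-- A `V`-natural isomorphism `F ≅ G` of `V`-functors: isomorphisms `F X ≅ G X` in the underlying
category for which the two composites `Hom X Y ⟶ Hom (F X) (G Y)` agree.  (Naturality is required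
on Hom objects; naturality of the underlying ordinary functors would be weaker.) -/
structure EnrichedNatIso {D : Type w₁} [EnrichedCategory V D] {E : Type w₂} [EnrichedCategory V E]
    (F G : EnrichedFunctor V D E) where
  /-- the components -/
  app (X : D) : ForgetEnrichment.of V (F.obj X) ≅ ForgetEnrichment.of V (G.obj X)
  naturality (X Y : D) :
    F.map X Y ≫ (ρ_ _).inv ≫ _ ◁ ForgetEnrichment.homTo V (app Y).hom ≫
        eComp V (F.obj X) (F.obj Y) (G.obj Y) =
      G.map X Y ≫ (λ_ _).inv ≫ ForgetEnrichment.homTo V (app X).hom ▷ _ ≫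
        eComp V (F.obj X) (G.obj X) (G.obj Y)

/-- `D` and `E` are equivalent as `V`-enriched categories. -/
def EnrichedEquivalent (D : Type w₁) [EnrichedCategory V D] (E : Type w₂)
    [EnrichedCategory V E] : Prop :=
  ∃ (F : EnrichedFunctor V D E) (G : EnrichedFunctor V E D),
    Nonempty (EnrichedNatIso V (F.comp V G) (EnrichedFunctor.id V D)) ∧
    Nonempty (EnrichedNatIso V (G.comp V F) (EnrichedFunctor.id V E))

end Equivalence

/-! ### Endomorphism monoids -/

section EndMon

variable (V : Type u) [Category.{v} V] [MonoidalCategory V] [SymmetricCategory V]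

/-- The endomorphism monoid `End(X)` of an object of a `V`-enriched category.  The product is
composition in the usual order `(g, f) ↦ g ∘ f`, so the symmetry is applied before `eComp`. -/
def endMon {D : Type w₁} [EnrichedCategory V D] (X : D) : Mon V where
  X := X ⟶[V] X
  mon :=
    { one := eId V X
      mul := (β_ _ _).hom ≫ eComp V X X X
      one_mul := by
        rw [BraidedCategory.braiding_naturality_left_assoc, braiding_tensorUnit_left]
        have h := e_comp_id V X X
        rw [Iso.inv_comp_eq, Category.comp_id] at h
        rw [Category.assoc, h, Iso.inv_hom_id, Category.comp_id]
      mul_one := by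
        rw [BraidedCategory.braiding_naturality_right_assoc, braiding_tensorUnit_right]
        have h := e_id_comp V X X
        rw [Iso.inv_comp_eq, Category.comp_id] at h
        rw [Category.assoc, h, Iso.inv_hom_id, Category.comp_id]
      mul_assoc := by
        have h := EnrichedCategory.assoc (V := V) (Opposite.op X) (Opposite.op X) (Opposite.op X)
          (Opposite.op X)
        rw [Iso.inv_comp_eq] at h
        exact h }

end EndMon

/-! ### Tensored enriched categories, tensorial strength, compact generators -/

section Tensored

variable (V : Type u) [Category.{v} V] [MonoidalCategory V] [MonoidalClosed V]

open MonoidalClosed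

/-- The covariant Hom functor `D(X,-) : D → V`, with action on Hom objects the transpose
`D(Y,Z) ⟶ [D(X,Y), D(X,Z)]` of composition. -/
def homFunctor {D : Type w₁} [EnrichedCategory V D] (X : D) : EnrichedFunctor V D V where
  obj Y := X ⟶[V] Y
  map Y Z := curry (eComp V X Y Z)
  map_id Y := by
    rw [enrichedCategorySelf_id, MonoidalClosed.id_eq, ← curry_natural_left]
    have h := e_comp_id V X Y
    rw [Iso.inv_comp_eq, Category.comp_id] at h
    rw [h]
  map_comp Y Z W := by
    rw [enrichedCategorySelf_comp, comp_eq, ← curry_natural_left, ← curry_natural_left]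
    congr 1
    have h (A B B' E E' : V) (f : A ⊗ B ⟶ E) (g : E ⊗ B' ⟶ E') :
        A ◁ (curry f ⊗ₘ curry g) ≫ (α_ _ _ _).inv ≫ (ihom.ev A).app E ▷ _ ≫ (ihom.ev E).app E' =
          (α_ _ _ _).inv ≫ f ▷ _ ≫ g := by
      rw [MonoidalCategory.tensorHom_def, MonoidalCategory.whiskerLeft_comp, Category.assoc,
        associator_inv_naturality_right_assoc]
      have e : (A ⊗ (ihom A).obj E) ◁ curry g ≫ (ihom.ev A).app E ▷ _ ≫ (ihom.ev E).app E' =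
          (ihom.ev A).app E ▷ _ ≫ E ◁ curry g ≫ (ihom.ev E).app E' :=
        whisker_exchange_assoc _ _ _
      rw [e, whiskerLeft_curry_ihom_ev_app, associator_inv_naturality_middle_assoc,
        ← comp_whiskerRight_assoc, whiskerLeft_curry_ihom_ev_app]
    rw [compTranspose_eq, ← e_assoc]
    exact (h _ _ _ _ _ _ _).symm

/-- The canonical comparison `D(T,Y) ⟶ [z, D(X,Y)]` induced by `c : z ⟶ D(X,T)`. -/
def tensorComparison {D : Type w₁} [EnrichedCategory V D] {z : V} {X T : D}
    (c : z ⟶ (X ⟶[V] T)) (Y : D) : (T ⟶[V] Y) ⟶ (ihom z).obj (X ⟶[V] Y) :=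
  curry (c ▷ _ ≫ eComp V X T Y)

/-- A tensored `V`-category: for all `z` and `X` there is an object `z ⊛ X` with a `V`-natural
isomorphism `D(z ⊛ X, Y) ≅ [z, D(X,Y)]`.  As usual (Yoneda), that isomorphism is given through its
value `coev : z ⟶ D(X, z ⊛ X)` on the identity, the unit of `- ⊛ X ⊣ D(X,-)`. -/
class Tensored (D : Type w₁) [EnrichedCategory V D] where
  /-- the tensor `z ⊛ X` -/
  obj : V → D → D
  /-- the unit `z ⟶ D(X, z ⊛ X)` -/
  coev (z : V) (X : D) : z ⟶ (X ⟶[V] obj z X)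
  isIso_comparison (z : V) (X Y : D) : IsIso (tensorComparison V (coev z X) Y)

attribute [instance] Tensored.isIso_comparison

/-- The morphism `z ⊛ X ⟶ Y` of the underlying category with right adjunct `f : z ⟶ D(X,Y)`. -/
def Tensored.desc {D : Type w₁} [EnrichedCategory V D] [Tensored V D] {z : V} {X Y : D}
    (f : z ⟶ (X ⟶[V] Y)) :
    ForgetEnrichment.of V (Tensored.obj z X) ⟶ ForgetEnrichment.of V Y :=
  ForgetEnrichment.homOf V
    (curry ((ρ_ z).hom ≫ f) ≫ inv (tensorComparison V (Tensored.coev z X) Y))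

/-- The tensorial strength `z ⊛ F X ⟶ F (z ⊛ X)` of a `V`-functor `F`: the morphism whose right
adjunct is `z ⟶ D(X, z ⊛ X) ⟶ E(F X, F (z ⊛ X))`. -/
def strength {D : Type w₁} [EnrichedCategory V D] [Tensored V D] {E : Type w₂}
    [EnrichedCategory V E] [Tensored V E] (F : EnrichedFunctor V D E) (z : V) (X : D) :
    ForgetEnrichment.of V (Tensored.obj z (F.obj X)) ⟶
      ForgetEnrichment.of V (F.obj (Tensored.obj z X)) :=
  Tensored.desc V (Tensored.coev z X ≫ F.map X (Tensored.obj z X))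

/-- `F` preserves `V`-tensors: its tensorial strength is invertible. -/
def PreservesTensors {D : Type w₁} [EnrichedCategory V D] [Tensored V D] {E : Type w₂}
    [EnrichedCategory V E] [Tensored V E] (F : EnrichedFunctor V D E) : Prop :=
  ∀ (z : V) (X : D), IsIso (strength V F z X)

end Tensored

/-! ### The closed symmetric monoidal base as a tensored category -/

section Base

variable (V : Type u) [Category.{v} V] [MonoidalCategory V] [SymmetricCategory V]
  [MonoidalClosed V]

open MonoidalClosed

/-- In `V` itself the tensor `z ⊛ x` is `z ⊗ x`. -/
instance tensoredSelf : Tensored V V where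
  obj z x := z ⊗ x
  coev z x := curry (β_ x z).hom
  isIso_comparison z x y := by
    let T : (ihom (z ⊗ x)).obj y ⟶ (ihom z).obj ((ihom x).obj y) :=
      curry (curry (β_ x z).hom ▷ _ ≫ MonoidalClosed.comp x (z ⊗ x) y)
    change IsIso T
    have key : x ◁ z ◁ T ≫ x ◁ (ihom.ev z).app ((ihom x).obj y) ≫ (ihom.ev x).app y =
        (α_ x z _).inv ≫ (β_ x z).hom ▷ _ ≫ (ihom.ev (z ⊗ x)).app y := by
      rw [← whiskerLeft_comp_assoc, whiskerLeft_curry_ihom_ev_app, comp_eq,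
        MonoidalCategory.whiskerLeft_comp, Category.assoc, whiskerLeft_curry_ihom_ev_app,
        compTranspose_eq, associator_inv_naturality_middle_assoc, ← comp_whiskerRight_assoc,
        whiskerLeft_curry_ihom_ev_app]
    refine ⟨curry ((β_ z x).hom ▷ _ ≫ (α_ x z _).hom ≫
      x ◁ (ihom.ev z).app ((ihom x).obj y) ≫ (ihom.ev x).app y), ?_, ?_⟩
    · apply uncurry_injective
      rw [uncurry_natural_left, uncurry_curry, whisker_exchange_assoc,
        associator_naturality_right_assoc, key, Iso.hom_inv_id_assoc, ← comp_whiskerRight_assoc,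
        SymmetricCategory.symmetry, id_whiskerRight, Category.id_comp, uncurry_id_eq_ev]
    · apply uncurry_injective
      apply uncurry_injective
      rw [uncurry_natural_left, uncurry_natural_left, uncurry_id_eq_ev, uncurry_eq, uncurry_eq,
        MonoidalCategory.whiskerLeft_comp, Category.assoc, key, uncurry_eq,
        associator_inv_naturality_right_assoc, whisker_exchange_assoc,
        whiskerLeft_curry_ihom_ev_app, ← comp_whiskerRight_assoc,
        SymmetricCategory.symmetry, id_whiskerRight, Category.id_comp, Iso.inv_hom_id_assoc]

variable {D : Type w₁} [EnrichedCategory V D]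

/-- `X` is a `V`-enriched compact object of the tensored `V`-category `D`: the Hom functor
`D(X,-) : D → V` preserves `V`-tensors, and its underlying functor preserves coequalizers. -/
structure IsCompactObject [Tensored V D] (X : D) : Prop where
  preservesTensors : PreservesTensors V (homFunctor V X)
  preservesCoequalizers :
    PreservesColimitsOfShape WalkingParallelPair (homFunctor V X).forget

/-- `X` is a `V`-enriched generator of `D`: the Hom functor `D(X,-) : D → V` is conservative. -/
def IsGenerator (X : D) : Prop :=
  (homFunctor V X).forget.ReflectsIsomorphisms

/-- `X` is a `V`-enriched compact generator. -/
def IsCompactGenerator [Tensored V D] (X : D) : Prop :=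
  IsCompactObject V X ∧ IsGenerator V X

end Base

/-! ### Right modules over a monoid -/

/-- A right module over a monoid `b`. -/
structure RightMod {C : Type u} [Category.{v} C] [MonoidalCategory C] (b : Mon C) where
  /-- the underlying object -/
  X : C
  /-- the action -/
  act : X ⊗ b.X ⟶ X
  act_one : X ◁ MonObj.one ≫ act = (ρ_ X).hom
  act_mul : X ◁ MonObj.mul ≫ act = (α_ X b.X b.X).inv ≫ act ▷ b.X ≫ act

namespace RightMod

open MonoidalClosed

variable {C : Type u} [Category.{v} C] [MonoidalCategory C] {b : Mon C}

/-- The monoid `b` as a right module over itself. -/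
def regular (b : Mon C) : RightMod b where
  X := b.X
  act := MonObj.mul
  act_one := by simp
  act_mul := by simp

/-- The right module `z ⊛ x`, with underlying object `z ⊗ x` and action `z ◁ act`. -/
def tensor (z : C) (x : RightMod b) : RightMod b where
  X := z ⊗ x.X
  act := (α_ _ _ _).hom ≫ z ◁ x.act
  act_one := by
    rw [tensor_whiskerLeft_assoc, Iso.inv_hom_id_assoc, ← whiskerLeft_comp, x.act_one]
    monoidal
  act_mul := by
    rw [tensor_whiskerLeft_assoc, Iso.inv_hom_id_assoc, ← whiskerLeft_comp, x.act_mul]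
    simp

variable [SymmetricCategory C] [MonoidalClosed C]

/-- The map `[x, y] ⟶ [x ⊗ b, y ⊗ b]` of Hom objects of the `C`-functor `- ⊗ b`. -/
def tensorRightMap (b x y : C) : (ihom x).obj y ⟶ (ihom (x ⊗ b)).obj (y ⊗ b) :=
  curry ((α_ _ _ _).hom ≫ x ◁ (β_ _ _).hom ≫ (α_ _ _ _).inv ≫ (ihom.ev x).app y ▷ b)

/-- `f : x ⊗ w ⟶ y` is `b`-linear in the variable `x`. -/
def IsLinear (x y : RightMod b) {w : C} (f : x.X ⊗ w ⟶ y.X) : Prop :=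
  x.act ▷ w ≫ f =
    (α_ _ _ _).hom ≫ x.X ◁ (β_ _ _).hom ≫ (α_ _ _ _).inv ≫ f ▷ b.X ≫ y.act

theorem isLinear_iff (x y : RightMod b) {w : C} (f : x.X ⊗ w ⟶ y.X) :
    IsLinear x y f ↔ curry f ≫ (pre x.act).app y.X =
      curry f ≫ tensorRightMap b.X x.X y.X ≫ (ihom (x.X ⊗ b.X)).map y.act := by
  rw [curry_pre_app, tensorRightMap, ← curry_natural_left_assoc, ← curry_natural_right,
    curry_injective.eq_iff, IsLinear]
  have h : (x.X ⊗ b.X) ◁ curry f ≫ (α_ _ _ _).hom ≫ x.X ◁ (β_ _ _).hom ≫ (α_ _ _ _).inv ≫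
      (ihom.ev x.X).app y.X ▷ b.X =
      (α_ _ _ _).hom ≫ x.X ◁ (β_ _ _).hom ≫ (α_ _ _ _).inv ≫ f ▷ b.X := by
    rw [tensor_whiskerLeft_assoc, Iso.inv_hom_id_assoc, ← whiskerLeft_comp_assoc,
      BraidedCategory.braiding_naturality_right, whiskerLeft_comp_assoc,
      associator_inv_naturality_middle_assoc, ← comp_whiskerRight, whiskerLeft_curry_ihom_ev_app]
  rw [h]
  simp only [Category.assoc]

variable [HasEqualizers C]

/-- The Hom object of right modules: the equalizer of `act_x^*` and `(act_y)_* ∘ (- ⊗ b)`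
from `[x, y]` to `[x ⊗ b, y]`. -/
def hom (x y : RightMod b) : C :=
  equalizer ((pre x.act).app y.X) (tensorRightMap b.X x.X y.X ≫ (ihom (x.X ⊗ b.X)).map y.act)

/-- The inclusion of the Hom object of right modules into the internal Hom of `C`. -/
def homι (x y : RightMod b) : hom x y ⟶ (ihom x.X).obj y.X :=
  equalizer.ι _ _

/-- Evaluation `x ⊗ Hom(x, y) ⟶ y`. -/
def homEv (x y : RightMod b) : x.X ⊗ hom x y ⟶ y.X :=
  uncurry (homι x y)

theorem homEv_isLinear (x y : RightMod b) : IsLinear x y (homEv x y) := by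
  rw [isLinear_iff, homEv, curry_uncurry]
  exact equalizer.condition _ _

/-- A `b`-linear `f : x ⊗ w ⟶ y` corresponds to a morphism `w ⟶ Hom(x, y)`. -/
def homLift {x y : RightMod b} {w : C} (f : x.X ⊗ w ⟶ y.X) (hf : IsLinear x y f) : w ⟶ hom x y :=
  equalizer.lift (curry f) ((isLinear_iff x y f).1 hf)

@[simp]
theorem homLift_ev {x y : RightMod b} {w : C} (f : x.X ⊗ w ⟶ y.X) (hf : IsLinear x y f) :
    x.X ◁ homLift f hf ≫ homEv x y = f := by
  have h : homLift f hf ≫ homι x y = curry f := equalizer.lift_ι _ _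
  rw [homEv, ← uncurry_natural_left, h, uncurry_curry]

theorem hom_ext {x y : RightMod b} {w : C} {f g : w ⟶ hom x y}
    (h : x.X ◁ f ≫ homEv x y = x.X ◁ g ≫ homEv x y) : f = g := by
  rw [homEv, ← uncurry_natural_left, ← uncurry_natural_left] at h
  exact equalizer.hom_ext (uncurry_injective h)

/-- The composition morphism `Hom(x, y) ⊗ Hom(y, z) ⟶ Hom(x, z)` of right modules. -/
def homComp (x y z : RightMod b) : hom x y ⊗ hom y z ⟶ hom x z :=
  homLift ((α_ _ _ _).inv ≫ homEv x y ▷ _ ≫ homEv y z) (by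
    have h₁ := homEv_isLinear x y
    have h₂ := homEv_isLinear y z
    simp only [IsLinear] at h₁ h₂ ⊢
    rw [associator_inv_naturality_left_assoc, ← comp_whiskerRight_assoc, h₁]
    simp only [comp_whiskerRight, Category.assoc]
    rw [h₂, associator_naturality_left_assoc, ← whisker_exchange_assoc,
      associator_inv_naturality_left_assoc, BraidedCategory.braiding_tensor_right_hom]
    monoidal)

/-- The identity `𝟙 ⟶ Hom(x, x)` of a right module. -/
def homId (x : RightMod b) : 𝟙_ C ⟶ hom x x :=
  homLift (ρ_ x.X).hom (by
    simp only [IsLinear]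
    simp)

/-- The `C`-enriched category of right `b`-modules. -/
instance enrichedCategory (b : Mon C) : EnrichedCategory C (RightMod b) where
  Hom := hom
  id := homId
  comp := homComp
  id_comp x y := by
    apply hom_ext
    rw [MonoidalCategory.whiskerLeft_comp, MonoidalCategory.whiskerLeft_comp, Category.assoc,
      Category.assoc, homComp, homLift_ev, associator_inv_naturality_middle_assoc,
      ← comp_whiskerRight_assoc, homId, homLift_ev]
    simp
  comp_id x y := by
    apply hom_ext
    rw [MonoidalCategory.whiskerLeft_comp, MonoidalCategory.whiskerLeft_comp, Category.assoc,
      Category.assoc, homComp, homLift_ev, associator_inv_naturality_right_assoc,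
      whisker_exchange_assoc, homId, homLift_ev]
    simp
  assoc x y z w := by
    apply hom_ext
    simp only [homComp, MonoidalCategory.whiskerLeft_comp, Category.assoc, homLift_ev,
      associator_inv_naturality_middle_assoc, associator_inv_naturality_right_assoc,
      whisker_exchange_assoc]
    rw [← comp_whiskerRight_assoc, homLift_ev]
    simp only [comp_whiskerRight, Category.assoc, pentagon_inv_assoc]
    monoidal

/-- The unit `z ⟶ Hom(x, z ⊛ x)`, induced by the symmetry `x ⊗ z ⟶ z ⊗ x`. -/
def homCoev (z : C) (x : RightMod b) : z ⟶ hom x (tensor z x) :=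
  homLift (β_ x.X z).hom (by
    simp only [IsLinear, tensor]
    rw [BraidedCategory.braiding_naturality_left, BraidedCategory.braiding_tensor_left_hom]
    simp)

theorem homCoev_ev (z : C) (x : RightMod b) :
    x.X ◁ homCoev z x ≫ homEv x (tensor z x) = (β_ x.X z).hom :=
  homLift_ev _ _

theorem comparison_aux₁ {C : Type u} [Category.{v} C] [MonoidalCategory C] [SymmetricCategory C]
    {a z P Q H y : C} (ev : z ⊗ Q ⟶ H) (e : a ⊗ H ⟶ y) (E : (z ⊗ a) ⊗ P ⟶ y) (T : P ⟶ Q)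
    (S : Q ⟶ P) (hT : a ◁ z ◁ T ≫ a ◁ ev ≫ e = (α_ _ _ _).inv ≫ (β_ a z).hom ▷ _ ≫ E)
    (hS : (z ⊗ a) ◁ S ≫ E = (β_ z a).hom ▷ _ ≫ (α_ _ _ _).hom ≫ a ◁ ev ≫ e) :
    (z ⊗ a) ◁ (T ≫ S) ≫ E = E := by
  rw [MonoidalCategory.whiskerLeft_comp, Category.assoc, hS, whisker_exchange_assoc,
    associator_naturality_right_assoc, hT, Iso.hom_inv_id_assoc, ← comp_whiskerRight_assoc,
    SymmetricCategory.symmetry, id_whiskerRight, Category.id_comp]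

theorem comparison_aux₂ {C : Type u} [Category.{v} C] [MonoidalCategory C] [SymmetricCategory C]
    {a z P Q H y : C} (ev : z ⊗ Q ⟶ H) (e : a ⊗ H ⟶ y) (E : (z ⊗ a) ⊗ P ⟶ y) (T : P ⟶ Q)
    (S : Q ⟶ P) (hT : a ◁ z ◁ T ≫ a ◁ ev ≫ e = (α_ _ _ _).inv ≫ (β_ a z).hom ▷ _ ≫ E)
    (hS : (z ⊗ a) ◁ S ≫ E = (β_ z a).hom ▷ _ ≫ (α_ _ _ _).hom ≫ a ◁ ev ≫ e) :
    a ◁ (z ◁ (S ≫ T) ≫ ev) ≫ e = a ◁ ev ≫ e := by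
  simp only [MonoidalCategory.whiskerLeft_comp, Category.assoc]
  rw [hT, associator_inv_naturality_right_assoc, whisker_exchange_assoc, hS,
    ← comp_whiskerRight_assoc, SymmetricCategory.symmetry, id_whiskerRight, Category.id_comp,
    Iso.inv_hom_id_assoc]

theorem comparison_aux₃ {C : Type u} [Category.{v} C] [MonoidalCategory C] [SymmetricCategory C]
    {a b z Q H y : C} (act : a ⊗ b ⟶ a) (act' : y ⊗ b ⟶ y) (ev : z ⊗ Q ⟶ H) (e : a ⊗ H ⟶ y)
    (h : act ▷ H ≫ e =
      (α_ _ _ _).hom ≫ a ◁ (β_ _ _).hom ≫ (α_ _ _ _).inv ≫ e ▷ b ≫ act') :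
    ((α_ _ _ _).hom ≫ z ◁ act) ▷ Q ≫ (β_ z a).hom ▷ _ ≫ (α_ _ _ _).hom ≫ a ◁ ev ≫ e =
      (α_ _ _ _).hom ≫ (z ⊗ a) ◁ (β_ _ _).hom ≫ (α_ _ _ _).inv ≫
        ((β_ z a).hom ▷ _ ≫ (α_ _ _ _).hom ≫ a ◁ ev ≫ e) ▷ b ≫ act' := by
  have e₁ : (z ◁ act) ▷ Q ≫ (β_ z a).hom ▷ _ = (β_ z (a ⊗ b)).hom ▷ _ ≫ act ▷ z ▷ _ := by
    rw [← comp_whiskerRight, BraidedCategory.braiding_naturality_right, comp_whiskerRight]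
  rw [comp_whiskerRight_assoc, reassoc_of% e₁, associator_naturality_left_assoc,
    ← whisker_exchange_assoc, h,
    tensor_whiskerLeft_assoc, Iso.inv_hom_id_assoc, ← whiskerLeft_comp_assoc a,
    BraidedCategory.braiding_naturality_right, whiskerLeft_comp_assoc,
    associator_inv_naturality_middle_assoc, BraidedCategory.braiding_tensor_right_hom,
    BraidedCategory.braiding_tensor_right_hom]
  simp only [comp_whiskerRight, Category.assoc, MonoidalCategory.whiskerLeft_comp]
  have e₂ : (a ◁ (β_ z b).hom) ▷ Q ≫ (α_ a b z).inv ▷ Q ≫ (α_ (a ⊗ b) z Q).hom ≫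
      (α_ a b (z ⊗ Q)).hom ≫ a ◁ (α_ b z Q).inv ≫ a ◁ (β_ b z).hom ▷ Q = (α_ a (z ⊗ b) Q).hom := by
    have e₃ : (α_ a b z).inv ▷ Q ≫ (α_ (a ⊗ b) z Q).hom ≫
      (α_ a b (z ⊗ Q)).hom ≫ a ◁ (α_ b z Q).inv = (α_ a (b ⊗ z) Q).hom := by monoidal
    rw [reassoc_of% e₃, associator_naturality_middle_assoc, ← MonoidalCategory.whiskerLeft_comp,
      ← comp_whiskerRight, SymmetricCategory.symmetry]
    simp
  rw [reassoc_of% e₂, ← associator_inv_naturality_left_assoc, whisker_exchange_assoc]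
  monoidal

/-- The `C`-enriched category of right `b`-modules is tensored, by `z ⊛ x = tensor z x`. -/
instance tensored (b : Mon C) : Tensored C (RightMod b) where
  obj := tensor
  coev := homCoev
  isIso_comparison z x y := by
    let T : hom (tensor z x) y ⟶ (ihom z).obj (hom x y) :=
      curry (homCoev z x ▷ _ ≫ homComp x (tensor z x) y)
    change IsIso T
    have key : x.X ◁ z ◁ T ≫ x.X ◁ (ihom.ev z).app (hom x y) ≫ homEv x y =
        (α_ x.X z _).inv ≫ (β_ x.X z).hom ▷ _ ≫ homEv (tensor z x) y := by
      rw [← whiskerLeft_comp_assoc, whiskerLeft_curry_ihom_ev_app, homComp,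
        MonoidalCategory.whiskerLeft_comp, Category.assoc, homLift_ev,
        associator_inv_naturality_middle_assoc, ← comp_whiskerRight_assoc, homCoev_ev]
      rfl
    let f : (tensor z x).X ⊗ (ihom z).obj (hom x y) ⟶ y.X := (β_ z x.X).hom ▷ _ ≫
      (α_ x.X z _).hom ≫ x.X ◁ (ihom.ev z).app (hom x y) ≫ homEv x y
    have hf : IsLinear (tensor z x) y f :=
      comparison_aux₃ x.act y.act ((ihom.ev z).app (hom x y)) (homEv x y) (homEv_isLinear x y)
    let S := homLift f hf
    have key' : (tensor z x).X ◁ S ≫ homEv (tensor z x) y = f := homLift_ev _ _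
    refine ⟨S, ?_, ?_⟩
    · apply hom_ext
      rw [MonoidalCategory.whiskerLeft_id, Category.id_comp]
      exact comparison_aux₁ _ _ _ T S key key'
    · apply uncurry_injective
      apply hom_ext
      rw [uncurry_id_eq_ev]
      exact comparison_aux₂ _ _ _ T S key key'

end RightMod

/-- Monoids `b` and `b'` are Morita equivalent: their categories of right modules are equivalent
as `C`-enriched categories. -/
def MoritaEquivalent {C : Type u} [Category.{v} C] [MonoidalCategory C] [SymmetricCategory C]
    [MonoidalClosed C] [HasEqualizers C] (b b' : Mon C) : Prop :=
  EnrichedEquivalent C (RightMod b) (RightMod b')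

end

end EnrichedMorita

/-!
The three conditions are linked in a cycle, which follows the Eilenberg-Watts argument.

From an equivalence to a compact generator: the free module `b` of rank one is a compact generator
of right `b`-modules, since `Hom(b, -)` is the underlying object functor
(`isCompactGenerator_regular`), and its endomorphism monoid is `b` (`endMonRegularIso`).  Mutually
inverse enriched functors are fully faithful and preserve tensors, and are adjoint to each other.
They therefore preserve compact generators (`IsCompactGenerator.map`) and endomorphism monoids
(`endMonIso`), so the image of `b` is as required.

From a compact generator `x` with `b ≅ End(x)` to bimodules: `x` is a bimodule through this
isomorphism, and its inverse is the dual `y = Hom(x, b')`.  Compactness says that `Hom(x, -)`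
commutes with coequalizers and with `w ⊗ -`, so it can be computed on every coequalizer of modules
`w ⊗ x` or `w ⊗ b'` (`nonempty_isColimit_homMap`).  Applied to the presentation
`x ⊗ b' ⊗ b' ⇉ x ⊗ b' ⟶ x` this presents `b ≅ Hom(x, x)` as the tensor product of `x` and `y` over
`b'` (`nonempty_tensor_dual_iso`).  Applied to the presentation of the tensor product of `y` and `x`
over `b` it shows that evaluation `y ⊗ x ⟶ b'` becomes invertible under `Hom(x, -)`, hence is
invertible since `x` is a generator (`nonempty_dual_tensor_iso`).

From bimodules to an equivalence: `- ⊛ x` is an enriched functor (`modTensorFunctor`), and the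
associativity of the tensor product of bimodules turns an isomorphism `x ⊛ y ≅ b` into an enriched
natural isomorphism `(z ⊛ x) ⊛ y ≅ z` (`nonempty_modTensorFunctor_comp_iso`).

Throughout, morphisms into a Hom object of modules are compared by applying them to elements: they
correspond to the linear families `w ⊗ x ⟶ y` (`homCurry`, `hom_ext_apply`).  With the Hom object on
the left of the module, linearity is stated without the symmetry of the monoidal structure.
-/

namespace EnrichedMorita

noncomputable section

open MonoidalClosed

/-! ### Hom objects of modules and linear families -/

namespace RightMod

variable {C : Type u} [Category.{v} C] [MonoidalCategory C] {b : Mon C}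

/-- `f : w ⊗ x ⟶ y` is `b`-linear in the variable `x`, the parameter `w` standing on the left.
Unlike `IsLinear`, this condition does not involve the symmetry. -/
def IsLinearFamily (x y : RightMod b) {w : C} (f : w ⊗ x.X ⟶ y.X) : Prop :=
  f ▷ b.X ≫ y.act = (α_ _ _ _).hom ≫ w ◁ x.act ≫ f

theorem linear_of_inverse {x y : RightMod b} (f : x.X ⟶ y.X) (g : y.X ⟶ x.X)
    (hf : f ▷ b.X ≫ y.act = x.act ≫ f) (h₁ : f ≫ g = 𝟙 _) (h₂ : g ≫ f = 𝟙 _) :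
    g ▷ b.X ≫ x.act = y.act ≫ g := by
  have : IsIso f := ⟨g, h₁, h₂⟩
  rw [← cancel_mono f, Category.assoc, Category.assoc, h₂, ← hf, ← comp_whiskerRight_assoc, h₂]
  simp

/-- If `h` acts on `y` through `a`, multiplicatively with respect to `n`, then a map `e` from `c`
to `h` that intertwines the two actions on `y` intertwines their compositions. -/
theorem tensorHom_mul_apply {c h y : C} (n : h ⊗ h ⟶ h) (a : h ⊗ y ⟶ y) (e : c ⟶ h)
    (k : c ⊗ y ⟶ y) (he : e ▷ y ≫ a = k) (hn : n ▷ y ≫ a = (α_ _ _ _).hom ≫ h ◁ a ≫ a) :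
    ((e ⊗ₘ e) ≫ n) ▷ y ≫ a = (α_ _ _ _).hom ≫ c ◁ k ≫ k := by
  rw [comp_whiskerRight, Category.assoc, hn, MonoidalCategory.tensorHom_def', comp_whiskerRight,
    Category.assoc, associator_naturality_left_assoc, ← whisker_exchange_assoc, he,
    associator_naturality_middle_assoc, ← MonoidalCategory.whiskerLeft_comp_assoc, he]

variable [SymmetricCategory C]

theorem isLinear_braiding_comp_iff (x y : RightMod b) {w : C} (f : w ⊗ x.X ⟶ y.X) :
    IsLinear x y ((β_ x.X w).hom ≫ f) ↔ IsLinearFamily x y f := by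
  rw [IsLinear, IsLinearFamily, BraidedCategory.braiding_naturality_left_assoc,
    BraidedCategory.braiding_tensor_left_hom]
  simp only [Category.assoc, comp_whiskerRight]
  constructor
  · intro h
    simp only [cancel_epi] at h
    exact h.symm
  · intro h
    rw [h]

variable [MonoidalClosed C] [HasEqualizers C]

/-- Application `Hom(x, y) ⊗ x ⟶ y`, with the Hom object on the left. -/
def homApply (x y : RightMod b) : hom x y ⊗ x.X ⟶ y.X :=
  (β_ _ _).hom ≫ homEv x y

theorem braiding_homApply (x y : RightMod b) :
    (β_ x.X (hom x y)).hom ≫ homApply x y = homEv x y := by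
  rw [homApply, SymmetricCategory.symmetry_assoc]

theorem homApply_linear (x y : RightMod b) :
    homApply x y ▷ b.X ≫ y.act = (α_ _ _ _).hom ≫ hom x y ◁ x.act ≫ homApply x y :=
  (isLinear_braiding_comp_iff x y _).1 (by
    rw [braiding_homApply]
    exact homEv_isLinear x y)

/-- The morphism `w ⟶ Hom(x, y)` that corresponds to a linear family `w ⊗ x ⟶ y`. -/
def homCurry {x y : RightMod b} {w : C} (f : w ⊗ x.X ⟶ y.X) (hf : IsLinearFamily x y f) :
    w ⟶ hom x y :=
  homLift ((β_ x.X w).hom ≫ f) ((isLinear_braiding_comp_iff x y f).2 hf)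

@[simp]
theorem homCurry_apply {x y : RightMod b} {w : C} (f : w ⊗ x.X ⟶ y.X)
    (hf : IsLinearFamily x y f) : homCurry f hf ▷ x.X ≫ homApply x y = f := by
  rw [homApply, BraidedCategory.braiding_naturality_left_assoc, homCurry, homLift_ev,
    SymmetricCategory.symmetry_assoc]

theorem hom_ext_apply {x y : RightMod b} {w : C} {f g : w ⟶ hom x y}
    (h : f ▷ x.X ≫ homApply x y = g ▷ x.X ≫ homApply x y) : f = g := by
  apply hom_ext
  rw [← braiding_homApply, BraidedCategory.braiding_naturality_right_assoc,
    BraidedCategory.braiding_naturality_right_assoc, h]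

@[simp]
theorem homId_apply (x : RightMod b) : homId x ▷ x.X ≫ homApply x x = (λ_ x.X).hom := by
  rw [homApply, BraidedCategory.braiding_naturality_left_assoc, homId, homLift_ev]
  simp

/-- The composite of `f : x ⟶ y` and `g : y ⟶ z` applied to `t` is `g (f t)`: the diagrammatic
order of composition forces the symmetry on the two Hom objects. -/
theorem homComp_apply (x y z : RightMod b) :
    homComp x y z ▷ x.X ≫ homApply x z =
      (β_ (hom x y) (hom y z)).hom ▷ x.X ≫ (α_ _ _ _).hom ≫ hom y z ◁ homApply x y ≫
        homApply y z := by
  have key (h k a : C) : (β_ (h ⊗ k) a).hom ≫ (α_ a h k).inv =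
      (β_ h k).hom ▷ a ≫ (α_ _ _ _).hom ≫ k ◁ (β_ h a).hom ≫ (β_ k (a ⊗ h)).hom := by
    rw [BraidedCategory.braiding_tensor_right_hom]
    have := BraidedCategory.braiding_tensor_left_hom k h a
    rw [← reassoc_of% this, ← BraidedCategory.braiding_naturality_left_assoc,
      ← comp_whiskerRight_assoc, SymmetricCategory.symmetry]
    simp
  rw [homApply, BraidedCategory.braiding_naturality_left_assoc, homComp, homLift_ev,
    reassoc_of% key, homApply, homApply, MonoidalCategory.whiskerLeft_comp, Category.assoc,
    BraidedCategory.braiding_naturality_right_assoc (hom y z) (homEv x y)]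

@[simp]
theorem homCoev_apply (z : C) (x : RightMod b) :
    homCoev z x ▷ x.X ≫ homApply x (tensor z x) = 𝟙 (z ⊗ x.X) := by
  rw [homApply, BraidedCategory.braiding_naturality_left_assoc, homCoev_ev]
  exact SymmetricCategory.symmetry _ _

end RightMod

/-! ### Compact generators in terms of the base category -/

section Base

variable {V : Type u} [Category.{v} V] [MonoidalCategory V] [MonoidalClosed V]

theorem equivFunctor_map_homFunctor {D : Type w₁} [EnrichedCategory V D] (X : D)
    {Y Z : D} (f : ForgetEnrichment.of V Y ⟶ ForgetEnrichment.of V Z) :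
    (ForgetEnrichment.equivFunctor V V).map ((homFunctor V X).forget.map f) =
      (ρ_ _).inv ≫ _ ◁ ForgetEnrichment.homTo V f ≫ eComp V X Y Z := by
  change uncurry' (ForgetEnrichment.homTo V f ≫ curry (eComp V X Y Z)) = _
  rw [← curry_natural_left, uncurry', uncurry_curry]

/-- In the base itself `Tensored.desc` is transposition along `- ⊗ a ⊣ [a, -]`, up to the symmetry
and the passage from `ForgetEnrichment V V` to `V`. -/
theorem equivFunctor_map_desc [SymmetricCategory V] {z a y : V} (f : z ⟶ (ihom a).obj y) :
    (ForgetEnrichment.equivFunctor V V).map (Tensored.desc V (X := a) (Y := y) f) =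
      (β_ z a).hom ≫ uncurry f := by
  set G : z ⊗ a ⟶ y :=
    (ForgetEnrichment.equivFunctor V V).map (Tensored.desc V (X := a) (Y := y) f) with hG
  have h₁ : curry' G = curry ((ρ_ z).hom ≫ f) ≫
      inv (tensorComparison V (Tensored.coev (V := V) z a) y) :=
    (curryHomEquiv' (X := z ⊗ a) (Y := y)).apply_symm_apply _
  have h₂ := (IsIso.eq_comp_inv _).1 h₁
  have h₃ : curry' G ≫ tensorComparison V (Tensored.coev (V := V) z a) y =
      curry ((ρ_ z).hom ≫ curry (β_ a z).hom ≫ (ihom a).map G) := by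
    change curry' G ≫ curry (curry (β_ a z).hom ▷ _ ≫ MonoidalClosed.comp a (z ⊗ a) y) = _
    rw [← curry_natural_left, whisker_exchange_assoc, whiskerLeft_curry'_comp,
      rightUnitor_naturality_assoc]
  rw [h₃] at h₂
  have h₄ := curry_injective h₂
  rw [cancel_epi, ← curry_natural_right] at h₄
  rw [← h₄, uncurry_curry, SymmetricCategory.symmetry_assoc]

/-- The functor represented by an object `X` of a `V`-enriched category, with values in `V` itself
instead of its isomorphic copy `ForgetEnrichment V V`. -/
def homToBase {D : Type w₁} [EnrichedCategory V D] (X : D) : ForgetEnrichment V D ⥤ V :=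
  (homFunctor V X).forget ⋙ ForgetEnrichment.equivFunctor V V

instance : (ForgetEnrichment.equivFunctor V V).IsEquivalence :=
  (ForgetEnrichment.equiv V (D := V)).isEquivalence_functor

variable [SymmetricCategory V] {D : Type w₁} [EnrichedCategory V D] [Tensored V D]

/-- The tensorial strength `z ⊗ D(X, Y) ⟶ D(X, z ⊛ Y)` of a represented functor, as a morphism of
the base: the unit of the tensor, composed with the given morphism. -/
def homTensorStrength (z : V) (X Y : D) : z ⊗ (X ⟶[V] Y) ⟶ (X ⟶[V] Tensored.obj z Y) :=
  (β_ _ _).hom ≫ (X ⟶[V] Y) ◁ Tensored.coev z Y ≫ eComp V X Y (Tensored.obj z Y)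

theorem equivFunctor_map_strength (z : V) (X Y : D) :
    (ForgetEnrichment.equivFunctor V V).map (strength V (homFunctor V X) z Y) =
      homTensorStrength z X Y := by
  refine (equivFunctor_map_desc (z := z) (a := X ⟶[V] Y) (y := X ⟶[V] Tensored.obj z Y)
    (Tensored.coev z Y ≫ curry (eComp V X Y (Tensored.obj z Y)))).trans ?_
  rw [← curry_natural_left, uncurry_curry, homTensorStrength]

theorem preservesTensors_homFunctor_iff (X : D) :
    PreservesTensors V (homFunctor V X) ↔ ∀ (z : V) (Y : D), IsIso (homTensorStrength z X Y) := by
  have key (z : V) (Y : D) :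
      IsIso (strength V (homFunctor V X) z Y) ↔ IsIso (homTensorStrength z X Y) := by
    rw [← equivFunctor_map_strength]
    exact (isIso_iff_of_reflects_iso _ (ForgetEnrichment.equivFunctor V V)).symm
  simp only [PreservesTensors, key]

/-- Compact generators in terms of the base category: invertibility of the maps
`z ⊗ D(X, Y) ⟶ D(X, z ⊛ Y)` and two properties of the ordinary functor `D(X, -)`. -/
theorem isCompactGenerator_iff (X : D) : IsCompactGenerator V X ↔
    (∀ (z : V) (Y : D), IsIso (homTensorStrength z X Y)) ∧
      PreservesColimitsOfShape WalkingParallelPair (homToBase (V := V) X) ∧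
        (homToBase (V := V) X).ReflectsIsomorphisms := by
  rw [← preservesTensors_homFunctor_iff]
  constructor
  · rintro ⟨⟨h₁, h₂⟩, h₃⟩
    have : (homFunctor V X).forget.ReflectsIsomorphisms := h₃
    exact ⟨h₁, inferInstanceAs (PreservesColimitsOfShape _ (_ ⋙ _)),
      inferInstanceAs (Functor.ReflectsIsomorphisms (_ ⋙ _))⟩
  · rintro ⟨h₁, h₂, h₃⟩
    have : PreservesColimitsOfShape WalkingParallelPair
      ((homFunctor V X).forget ⋙ ForgetEnrichment.equivFunctor V V) := h₂
    have : ((homFunctor V X).forget ⋙ ForgetEnrichment.equivFunctor V V).ReflectsIsomorphisms :=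
      h₃
    exact ⟨⟨h₁, preservesColimitsOfShape_of_reflects_of_preserves _
      (ForgetEnrichment.equivFunctor V V)⟩,
      reflectsIsomorphisms_of_comp _ (ForgetEnrichment.equivFunctor V V)⟩

end Base

/-! ### Linear maps and the underlying object functor -/

namespace RightMod

variable {C : Type u} [Category.{v} C] [MonoidalCategory C] [SymmetricCategory C]
  [MonoidalClosed C] [HasEqualizers C] {b : Mon C}

/-- The linear map `x ⟶ y` represented by an element `𝟙 ⟶ Hom(x, y)`. -/
def ofElement {x y : RightMod b} (f : 𝟙_ C ⟶ hom x y) : x.X ⟶ y.X :=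
  (λ_ _).inv ≫ f ▷ _ ≫ homApply x y

theorem ofElement_id (x : RightMod b) : ofElement (homId x) = 𝟙 x.X := by
  rw [ofElement, homId_apply, Iso.inv_hom_id]

theorem ofElement_comp {x y z : RightMod b} (f : 𝟙_ C ⟶ hom x y) (g : 𝟙_ C ⟶ hom y z) :
    ofElement ((λ_ _).inv ≫ (f ⊗ₘ g) ≫ homComp x y z) = ofElement f ≫ ofElement g := by
  simp only [ofElement, comp_whiskerRight, Category.assoc]
  rw [homComp_apply, ← comp_whiskerRight_assoc _ (β_ _ _).hom,
    BraidedCategory.braiding_naturality, MonoidalCategory.tensorHom_def]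
  simp only [comp_whiskerRight, Category.assoc, braiding_tensorUnit_left]
  rw [associator_naturality_middle_assoc, ← MonoidalCategory.whiskerLeft_comp_assoc,
    associator_naturality_left_assoc, ← whisker_exchange_assoc]
  simp

theorem ofElement_linear {x y : RightMod b} (f : 𝟙_ C ⟶ hom x y) :
    ofElement f ▷ b.X ≫ y.act = x.act ≫ ofElement f := by
  simp only [ofElement, comp_whiskerRight, Category.assoc]
  rw [homApply_linear, associator_naturality_left_assoc, ← whisker_exchange_assoc]
  simp

/-- The element of `Hom(x, y)` given by a linear map `x ⟶ y`. -/
def element {x y : RightMod b} (f : x.X ⟶ y.X) (hf : f ▷ b.X ≫ y.act = x.act ≫ f) :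
    𝟙_ C ⟶ hom x y :=
  homCurry ((λ_ _).hom ≫ f) (by
    rw [IsLinearFamily, comp_whiskerRight, Category.assoc, hf]
    simp)

@[simp]
theorem ofElement_element {x y : RightMod b} (f : x.X ⟶ y.X)
    (hf : f ▷ b.X ≫ y.act = x.act ≫ f) : ofElement (element f hf) = f := by
  rw [ofElement, element, homCurry_apply, Iso.inv_hom_id_assoc]

theorem ofElement_injective {x y : RightMod b} :
    Function.Injective (ofElement : (𝟙_ C ⟶ hom x y) → (x.X ⟶ y.X)) := by
  intro f g h
  apply hom_ext_apply
  simpa [ofElement] using h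

/-- The functor that sends a right `b`-module to its underlying object and a morphism
`𝟙 ⟶ Hom(x, y)` to the linear map `x ⟶ y` it represents. -/
def underlying (b : Mon C) : ForgetEnrichment C (RightMod b) ⥤ C where
  obj x := (ForgetEnrichment.to C x).X
  map {x y} f := ofElement (x := ForgetEnrichment.to C x) (y := ForgetEnrichment.to C y)
    (ForgetEnrichment.homTo C f)
  map_id x := by
    rw [ForgetEnrichment.homTo_id]
    exact ofElement_id _
  map_comp {x y z} f g := by
    rw [ForgetEnrichment.homTo_comp, Category.assoc]
    exact ofElement_comp (x := ForgetEnrichment.to C x) (y := ForgetEnrichment.to C y)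
      (z := ForgetEnrichment.to C z) _ _

/-- A linear map as a morphism of the underlying category of right `b`-modules. -/
def ofLinear {x y : RightMod b} (f : x.X ⟶ y.X) (hf : f ▷ b.X ≫ y.act = x.act ≫ f) :
    ForgetEnrichment.of C x ⟶ ForgetEnrichment.of C y :=
  ForgetEnrichment.homOf C (element f hf)

theorem underlying_map_ofLinear {x y : RightMod b} (f : x.X ⟶ y.X)
    (hf : f ▷ b.X ≫ y.act = x.act ≫ f) : (underlying b).map (ofLinear f hf) = f :=
  ofElement_element f hf

theorem underlying_map_linear {x y : ForgetEnrichment C (RightMod b)} (f : x ⟶ y) :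
    (underlying b).map f ▷ b.X ≫ (ForgetEnrichment.to C y).act =
      (ForgetEnrichment.to C x).act ≫ (underlying b).map f :=
  ofElement_linear (x := ForgetEnrichment.to C x) (y := ForgetEnrichment.to C y) _

instance : (underlying b).Faithful where
  map_injective {x y} _ _ h :=
    ofElement_injective (x := ForgetEnrichment.to C x) (y := ForgetEnrichment.to C y) h

instance : (underlying b).ReflectsIsomorphisms where
  reflects {x y} f h := by
    obtain ⟨g, h₁, h₂⟩ := h
    change (ForgetEnrichment.to C y).X ⟶ (ForgetEnrichment.to C x).X at g
    have hg : g ▷ b.X ≫ (ForgetEnrichment.to C x).act = (ForgetEnrichment.to C y).act ≫ g := by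
      exact linear_of_inverse _ g (underlying_map_linear f) h₁ h₂
    refine ⟨ofLinear (x := ForgetEnrichment.to C y) (y := ForgetEnrichment.to C x) g hg, ?_, ?_⟩
    · apply (underlying b).map_injective
      exact ((underlying b).map_comp _ _).trans
        ((congrArg _ (underlying_map_ofLinear g hg)).trans (h₁.trans ((underlying b).map_id _).symm))
    · apply (underlying b).map_injective
      exact ((underlying b).map_comp _ _).trans
        ((congrArg (· ≫ _) (underlying_map_ofLinear g hg)).trans
          (h₂.trans ((underlying b).map_id _).symm))

end RightMod

/-! ### Coequalizers of modules -/

namespace RightMod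

variable {C : Type u} [Category.{v} C] [MonoidalCategory C] [SymmetricCategory C]
  [MonoidalClosed C] {b : Mon C}

section Coequalizer

variable [HasCoequalizers C] {P Q : RightMod b} (f g : P.X ⟶ Q.X)
  (hf : f ▷ b.X ≫ Q.act = P.act ≫ f) (hg : g ▷ b.X ≫ Q.act = P.act ≫ g)

/-- The action on the coequalizer, in the base category, of two linear maps.  It exists since
`- ⊗ b` preserves coequalizers. -/
def coequalizerAct : coequalizer f g ⊗ b.X ⟶ coequalizer f g :=
  Cofork.IsColimit.desc (isColimitOfHasCoequalizerOfPreservesColimit (tensorRight b.X) f g)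
    (Q.act ≫ coequalizer.π f g) (by
      change f ▷ b.X ≫ _ = g ▷ b.X ≫ _
      rw [reassoc_of% hf, reassoc_of% hg, coequalizer.condition])

theorem π_coequalizerAct :
    coequalizer.π f g ▷ b.X ≫ coequalizerAct f g hf hg = Q.act ≫ coequalizer.π f g :=
  Cofork.IsColimit.π_desc'
    (isColimitOfHasCoequalizerOfPreservesColimit (tensorRight b.X) f g) _ _

instance epi_whiskerRight {x y : C} (q : x ⟶ y) [Epi q] (z : C) : Epi (q ▷ z) :=
  inferInstanceAs (Epi ((tensorRight z).map q))

instance epi_whiskerLeft {x y : C} (q : x ⟶ y) [Epi q] (z : C) : Epi (z ◁ q) :=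
  inferInstanceAs (Epi ((tensorLeft z).map q))

/-- The coequalizer, in the base category, of two linear maps, as a right module. -/
def coequalizerMod : RightMod b where
  X := coequalizer f g
  act := coequalizerAct f g hf hg
  act_one := by
    rw [← cancel_epi (coequalizer.π f g ▷ 𝟙_ C), ← whisker_exchange_assoc, π_coequalizerAct,
      ← Category.assoc, Q.act_one]
    simp
  act_mul := by
    rw [← cancel_epi (coequalizer.π f g ▷ (b.X ⊗ b.X)), ← whisker_exchange_assoc,
      π_coequalizerAct, ← Category.assoc, Q.act_mul, associator_inv_naturality_left_assoc,
      ← comp_whiskerRight_assoc, π_coequalizerAct, comp_whiskerRight_assoc, π_coequalizerAct]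
    simp

end Coequalizer

/-- Linearity descends along a linear epimorphism. -/
theorem linear_of_epi {x y z : RightMod b} (q : x.X ⟶ y.X) [hq : Epi q] (k : y.X ⟶ z.X)
    (h : q ▷ b.X ≫ y.act = x.act ≫ q) {r : x.X ⟶ z.X} (hk : q ≫ k = r)
    (hr : r ▷ b.X ≫ z.act = x.act ≫ r) : k ▷ b.X ≫ z.act = y.act ≫ k := by
  rw [← cancel_epi (q ▷ b.X), reassoc_of% h, hk, ← hr, ← hk, comp_whiskerRight_assoc]

variable [HasEqualizers C]

/-- A cofork of linear maps is a coequalizer as soon as it is one in the base category. -/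
theorem nonempty_isColimit_of_underlying {P Q T : ForgetEnrichment C (RightMod b)} {f g : P ⟶ Q}
    {q : Q ⟶ T} (w : f ≫ q = g ≫ q)
    (l : IsColimit (Cofork.ofπ ((underlying b).map q)
      (by rw [← Functor.map_comp, w, Functor.map_comp]) :
        Cofork ((underlying b).map f) ((underlying b).map g))) :
    Nonempty (IsColimit (Cofork.ofπ q w)) := by
  have hq : Epi ((underlying b).map q) := epi_of_isColimit_cofork l
  have key (s : Cofork f g) : ∃ k : (ForgetEnrichment.to C T).X ⟶ (ForgetEnrichment.to C s.pt).X,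
      (underlying b).map q ≫ k = (underlying b).map s.π ∧
      k ▷ b.X ≫ (ForgetEnrichment.to C s.pt).act = (ForgetEnrichment.to C T).act ≫ k := by
    obtain ⟨k, hk⟩ := Cofork.IsColimit.desc' l ((underlying b).map s.π) (by
      rw [← Functor.map_comp, s.condition, Functor.map_comp])
    change (underlying b).map q ≫ k = _ at hk
    refine ⟨k, hk, ?_⟩
    refine linear_of_epi (x := ForgetEnrichment.to C Q) (y := ForgetEnrichment.to C T)
      (z := ForgetEnrichment.to C s.pt) ((underlying b).map q) (hq := hq) k
      (underlying_map_linear q) hk (underlying_map_linear s.π)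
  choose k hk hl using key
  refine ⟨Cofork.IsColimit.mk _ (fun s => ofLinear (k s) (hl s)) (fun s => ?_) (fun s m hm => ?_)⟩
  · apply (underlying b).map_injective
    exact ((underlying b).map_comp _ _).trans
      ((congrArg (_ ≫ ·) (underlying_map_ofLinear (k s) (hl s))).trans (hk s))
  · apply (underlying b).map_injective
    refine Eq.trans ?_ (underlying_map_ofLinear (k s) (hl s)).symm
    apply hq.left_cancellation
    exact (((underlying b).map_comp _ _).symm.trans (congrArg _ hm)).trans (hk s).symm

instance [HasCoequalizers C] : PreservesColimitsOfShape WalkingParallelPair (underlying b) where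
  preservesColimit {K} := by
    have (P Q : RightMod b) (f g : ForgetEnrichment.of C P ⟶ ForgetEnrichment.of C Q) :
        PreservesColimit (parallelPair f g) (underlying b) := by
      let f' : P.X ⟶ Q.X := (underlying b).map f
      let g' : P.X ⟶ Q.X := (underlying b).map g
      have hf : f' ▷ b.X ≫ Q.act = P.act ≫ f' := underlying_map_linear f
      have hg : g' ▷ b.X ≫ Q.act = P.act ≫ g' := underlying_map_linear g
      let q : ForgetEnrichment.of C Q ⟶ ForgetEnrichment.of C (coequalizerMod f' g' hf hg) :=
        ofLinear (coequalizer.π f' g') (π_coequalizerAct f' g' hf hg)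
      have hq : (underlying b).map q = coequalizer.π f' g' := underlying_map_ofLinear _ _
      have w : f ≫ q = g ≫ q := by
        apply (underlying b).map_injective
        rw [Functor.map_comp, Functor.map_comp, hq]
        exact coequalizer.condition f' g'
      have l : IsColimit (Cofork.ofπ ((underlying b).map q)
          (by rw [← Functor.map_comp, w, Functor.map_comp]) :
            Cofork ((underlying b).map f) ((underlying b).map g)) :=
        (coequalizerIsCoequalizer f' g').ofIsoColimit
          (Cofork.ext (Iso.refl _) ((Category.comp_id _).trans hq.symm))
      obtain ⟨l'⟩ := nonempty_isColimit_of_underlying w l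
      exact preservesColimit_of_preserves_colimit_cocone l'
        ((isColimitMapCoconeCoforkEquiv _ _).symm l)
    have := this _ _ (K.map WalkingParallelPairHom.left) (K.map WalkingParallelPairHom.right)
    exact preservesColimit_of_iso_diagram _ (diagramIsoParallelPair K).symm

end RightMod

/-! ### The free module of rank one -/

namespace RightMod

variable {C : Type u} [Category.{v} C] [MonoidalCategory C] [SymmetricCategory C]
  [MonoidalClosed C] [HasEqualizers C] {b : Mon C}

/-- The map `Hom(x, y) ⟶ Hom(x, z)` induced by a linear map `y ⟶ z`. -/
def homMap (x : RightMod b) {y z : RightMod b} (f : y.X ⟶ z.X)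
    (hf : f ▷ b.X ≫ z.act = y.act ≫ f) : hom x y ⟶ hom x z :=
  homCurry (homApply x y ≫ f) (by
    rw [IsLinearFamily, comp_whiskerRight, Category.assoc, hf, reassoc_of% homApply_linear])

@[simp]
theorem homMap_apply (x : RightMod b) {y z : RightMod b} (f : y.X ⟶ z.X)
    (hf : f ▷ b.X ≫ z.act = y.act ≫ f) :
    homMap x f hf ▷ x.X ≫ homApply x z = homApply x y ≫ f :=
  homCurry_apply _ _

theorem homMap_ofElement (x : RightMod b) {y z : RightMod b} (f : 𝟙_ C ⟶ hom y z) :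
    (ρ_ _).inv ≫ hom x y ◁ f ≫ homComp x y z = homMap x (ofElement f) (ofElement_linear f) := by
  apply hom_ext_apply
  rw [homMap_apply]
  simp only [comp_whiskerRight, Category.assoc]
  rw [homComp_apply, ← comp_whiskerRight_assoc _ (β_ _ _).hom,
    BraidedCategory.braiding_naturality_right]
  simp only [comp_whiskerRight, Category.assoc, braiding_tensorUnit_right, ofElement]
  rw [associator_naturality_left_assoc, ← whisker_exchange_assoc]
  simp

theorem homFunctor_map (x : RightMod b) {y z : ForgetEnrichment C (RightMod b)} (f : y ⟶ z) :
    (ForgetEnrichment.equivFunctor C C).map ((homFunctor C x).forget.map f) =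
      homMap x (y := ForgetEnrichment.to C y) (z := ForgetEnrichment.to C z)
        ((underlying b).map f) (underlying_map_linear f) :=
  (equivFunctor_map_homFunctor x f).trans (homMap_ofElement x (y := ForgetEnrichment.to C y)
    (z := ForgetEnrichment.to C z) (ForgetEnrichment.homTo C f))

/-- The tensorial strength `z ⊗ Hom(x, y) ⟶ Hom(x, z ⊗ y)`, as a morphism of the base. -/
def homStrength (z : C) (x y : RightMod b) : z ⊗ hom x y ⟶ hom x (tensor z y) :=
  homCurry (y := tensor z y) ((α_ _ _ _).hom ≫ z ◁ homApply x y) (by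
    have := homApply_linear x y
    simp only [IsLinearFamily, tensor, comp_whiskerRight, Category.assoc, whisker_assoc]
    rw [Iso.inv_hom_id_assoc, ← MonoidalCategory.whiskerLeft_comp, this]
    simp)

theorem homStrength_apply (z : C) (x y : RightMod b) :
    homStrength z x y ▷ x.X ≫ homApply x (tensor z y) = (α_ _ _ _).hom ≫ z ◁ homApply x y :=
  homCurry_apply _ _

theorem homStrength_eq (z : C) (x y : RightMod b) :
    homStrength z x y = homTensorStrength z x y := by
  change _ = (β_ _ _).hom ≫ hom x y ◁ homCoev z y ≫ homComp x y (tensor z y)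
  apply hom_ext_apply
  rw [homStrength_apply]
  simp only [comp_whiskerRight, Category.assoc]
  rw [homComp_apply, ← comp_whiskerRight_assoc _ (β_ _ _).hom,
    BraidedCategory.braiding_naturality_right, ← comp_whiskerRight_assoc,
    SymmetricCategory.symmetry_assoc, associator_naturality_left_assoc, ← whisker_exchange_assoc,
    homCoev_apply]
  exact (congrArg (_ ≫ ·) (Category.comp_id _)).symm

/-- Application `Hom(b, y) ⊗ b ⟶ y` for the free module `b` of rank one. -/
def applyRegular (y : RightMod b) : hom (regular b) y ⊗ b.X ⟶ y.X :=
  homApply (regular b) y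

theorem applyRegular_linear (y : RightMod b) :
    applyRegular y ▷ b.X ≫ y.act = (α_ _ _ _).hom ≫ _ ◁ MonObj.mul ≫ applyRegular y :=
  homApply_linear (regular b) y

theorem hom_ext_applyRegular {y : RightMod b} {w : C} {f g : w ⟶ hom (regular b) y}
    (h : f ▷ b.X ≫ applyRegular y = g ▷ b.X ≫ applyRegular y) : f = g :=
  hom_ext_apply h

/-- An element of a module as a linear map out of the free module of rank one. -/
def ofPoint (y : RightMod b) : y.X ⟶ hom (regular b) y :=
  homCurry (x := regular b) y.act (by
    have h : y.act ▷ b.X ≫ y.act = (α_ _ _ _).hom ≫ y.X ◁ MonObj.mul ≫ y.act := by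
      rw [y.act_mul, Iso.hom_inv_id_assoc]
    exact h)

theorem ofPoint_apply (y : RightMod b) : ofPoint y ▷ b.X ≫ applyRegular y = y.act :=
  homCurry_apply (x := regular b) y.act _

/-- The free module of rank one represents the underlying object: `Hom(b, y) ≅ y`. -/
def homRegularIso (y : RightMod b) : hom (regular b) y ≅ y.X where
  hom := (ρ_ _).inv ≫ _ ◁ MonObj.one ≫ applyRegular y
  inv := ofPoint y
  hom_inv_id := by
    apply hom_ext_applyRegular
    rw [comp_whiskerRight, Category.assoc, ofPoint_apply, id_whiskerRight]
    simp only [comp_whiskerRight, Category.assoc, applyRegular_linear]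
    rw [associator_naturality_middle_assoc, ← MonoidalCategory.whiskerLeft_comp_assoc,
      MonObj.one_mul]
    simp
  inv_hom_id := by
    rw [rightUnitor_inv_naturality_assoc, ← whisker_exchange_assoc, ofPoint_apply, y.act_one,
      Iso.inv_hom_id]

theorem homMap_homRegularIso {y z : RightMod b} (f : y.X ⟶ z.X)
    (hf : f ▷ b.X ≫ z.act = y.act ≫ f) :
    homMap (regular b) f hf ≫ (homRegularIso z).hom = (homRegularIso y).hom ≫ f := by
  have : homMap (regular b) f hf ▷ b.X ≫ applyRegular z = applyRegular y ≫ f :=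
    homMap_apply (regular b) f hf
  simp only [homRegularIso, Category.assoc]
  rw [rightUnitor_inv_naturality_assoc, ← whisker_exchange_assoc, this]

theorem homStrength_homRegularIso (z : C) (y : RightMod b) :
    homStrength z (regular b) y ≫ (homRegularIso (tensor z y)).hom =
      z ◁ (homRegularIso y).hom := by
  have : homStrength z (regular b) y ▷ b.X ≫ applyRegular (tensor z y) =
    (α_ _ _ _).hom ≫ z ◁ applyRegular y := homStrength_apply z (regular b) y
  simp only [homRegularIso]
  rw [rightUnitor_inv_naturality_assoc, ← whisker_exchange_assoc, this]
  change (ρ_ _).inv ≫ _ ◁ MonObj.one ≫ (α_ z _ _).hom ≫ z ◁ (_ : _ ⟶ y.X) = _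
  rw [associator_naturality_right_assoc]
  simp

/-- Hom out of the free module of rank one is the underlying object functor. -/
def homToBaseRegularIso (b : Mon C) : homToBase (V := C) (regular b) ≅ underlying b :=
  NatIso.ofComponents (fun y => homRegularIso (ForgetEnrichment.to C y)) (fun {y z} f =>
    (congrArg (· ≫ _) (homFunctor_map (regular b) f)).trans
      (homMap_homRegularIso (y := ForgetEnrichment.to C y) (z := ForgetEnrichment.to C z) _ _))

/-- The free module of rank one is a compact generator: Hom out of it is the underlying object
functor, which commutes with tensors and coequalizers. -/
theorem isCompactGenerator_regular [HasCoequalizers C] (b : Mon C) :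
    IsCompactGenerator C (regular b) := by
  refine (isCompactGenerator_iff _).2 ⟨fun z y => ?_,
    preservesColimitsOfShape_of_natIso (homToBaseRegularIso b).symm,
    reflectsIsomorphisms_of_iso (homToBaseRegularIso b).symm⟩
  have h := homStrength_homRegularIso z y
  have : IsIso (homStrength z (regular b) y ≫ (homRegularIso (tensor z y)).hom) := by
    rw [h]
    exact inferInstanceAs (IsIso (z ◁ (homRegularIso y).hom))
  rw [← homStrength_eq]
  exact IsIso.of_isIso_comp_right _ (homRegularIso (tensor z y)).hom

/-- The endomorphism monoid acts on `x` from the left by application. -/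
theorem endMon_mul_apply (x : RightMod b) :
    (MonObj.mul (X := (endMon C x).X) : hom x x ⊗ hom x x ⟶ hom x x) ▷ x.X ≫ homApply x x =
      (α_ _ _ _).hom ≫ hom x x ◁ homApply x x ≫ homApply x x := by
  change ((β_ (hom x x) (hom x x)).hom ≫ homComp x x x) ▷ x.X ≫ homApply x x = _
  rw [comp_whiskerRight, Category.assoc, homComp_apply, ← comp_whiskerRight_assoc,
    SymmetricCategory.symmetry]
  simp

theorem endMon_one_apply (x : RightMod b) :
    (MonObj.one (X := (endMon C x).X) : 𝟙_ C ⟶ hom x x) ▷ x.X ≫ homApply x x =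
      (λ_ _).hom :=
  homId_apply x

/-- A monoid is the endomorphism monoid of its free module of rank one. -/
def endMonRegularIso (b : Mon C) : b ≅ endMon C (regular b) :=
  have h₁ : ofPoint (regular b) ▷ b.X ≫ applyRegular (regular b) = MonObj.mul (X := b.X) :=
    ofPoint_apply (regular b)
  Mon.mkIso (M := b) (N := endMon C (regular b)) (homRegularIso (regular b)).symm
    (by
      apply hom_ext_applyRegular
      refine Eq.trans ?_ (endMon_one_apply (regular b)).symm
      refine (congrArg (· ≫ _) (comp_whiskerRight _ _ _)).trans ((Category.assoc _ _ _).trans ?_)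
      exact (congrArg (_ ≫ ·) h₁).trans (MonObj.one_mul b.X))
    (by
      apply hom_ext_applyRegular
      refine Eq.trans ?_ (tensorHom_mul_apply _ _ _ _ h₁ (endMon_mul_apply (regular b))).symm
      refine (congrArg (· ≫ _) (comp_whiskerRight _ _ _)).trans ((Category.assoc _ _ _).trans ?_)
      exact (congrArg (_ ≫ ·) h₁).trans (MonObj.mul_assoc b.X))

end RightMod

/-! ### Inverse enriched functors are fully faithful -/

section Enriched

variable {V : Type u} [Category.{v} V] [MonoidalCategory V] {D : Type w₁} [EnrichedCategory V D]
  {E : Type w₂} [EnrichedCategory V E]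

/-- The map `D(X, Y) ⟶ D(X, Z)` given by composition with `g : Y ⟶ Z`. -/
def postcomp (X : D) {Y Z : D} (g : ForgetEnrichment.of V Y ⟶ ForgetEnrichment.of V Z) :
    (X ⟶[V] Y) ⟶ (X ⟶[V] Z) :=
  (ρ_ _).inv ≫ _ ◁ ForgetEnrichment.homTo V g ≫ eComp V X Y Z

/-- The map `D(Y, Z) ⟶ D(X, Z)` given by composition with `f : X ⟶ Y`. -/
def precomp {X Y : D} (f : ForgetEnrichment.of V X ⟶ ForgetEnrichment.of V Y) (Z : D) :
    (Y ⟶[V] Z) ⟶ (X ⟶[V] Z) :=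
  (λ_ _).inv ≫ ForgetEnrichment.homTo V f ▷ _ ≫ eComp V X Y Z

theorem postcomp_comp (X : D) {Y Z W : D}
    (g : ForgetEnrichment.of V Y ⟶ ForgetEnrichment.of V Z)
    (h : ForgetEnrichment.of V Z ⟶ ForgetEnrichment.of V W) :
    postcomp X (g ≫ h) = postcomp X g ≫ postcomp X h :=
  eHomWhiskerLeft_comp V (ForgetEnrichment.of V X) g h

theorem postcomp_id (X Y : D) : postcomp X (𝟙 (ForgetEnrichment.of V Y)) = 𝟙 (X ⟶[V] Y) :=
  eHomWhiskerLeft_id V (ForgetEnrichment.of V X) (ForgetEnrichment.of V Y)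

theorem precomp_comp {X Y Z : D}
    (f : ForgetEnrichment.of V X ⟶ ForgetEnrichment.of V Y)
    (g : ForgetEnrichment.of V Y ⟶ ForgetEnrichment.of V Z) (W : D) :
    precomp (f ≫ g) W = precomp g W ≫ precomp f W :=
  eHomWhiskerRight_comp V f g (ForgetEnrichment.of V W)

theorem precomp_id (X Y : D) : precomp (𝟙 (ForgetEnrichment.of V X)) Y = 𝟙 (X ⟶[V] Y) :=
  eHomWhiskerRight_id V (ForgetEnrichment.of V X) (ForgetEnrichment.of V Y)

theorem eComp_postcomp (X Y : D) {Z W : D}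
    (g : ForgetEnrichment.of V Z ⟶ ForgetEnrichment.of V W) :
    eComp V X Y Z ≫ postcomp X g = _ ◁ postcomp Y g ≫ eComp V X Y W :=
  eComp_eHomWhiskerLeft V (ForgetEnrichment.of V X) (ForgetEnrichment.of V Y) g

theorem postcomp_eComp (X : D) {Y Z : D} (g : ForgetEnrichment.of V Y ⟶ ForgetEnrichment.of V Z)
    (W : D) : postcomp X g ▷ _ ≫ eComp V X Z W = _ ◁ precomp g W ≫ eComp V X Y W := by
  have key (g : 𝟙_ V ⟶ (Y ⟶[V] Z)) :
      ((ρ_ (X ⟶[V] Y)).inv ≫ _ ◁ g ≫ eComp V X Y Z) ▷ _ ≫ eComp V X Z W =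
        _ ◁ ((λ_ (Z ⟶[V] W)).inv ≫ g ▷ _ ≫ eComp V Y Z W) ≫ eComp V X Y W := by
    simp only [comp_whiskerRight, MonoidalCategory.whiskerLeft_comp, Category.assoc]
    rw [← e_assoc, associator_inv_naturality_middle_assoc]
    simp
  exact key _

theorem homTo_comp_precomp {X Y Z : D} (f : ForgetEnrichment.of V X ⟶ ForgetEnrichment.of V Y)
    (g : ForgetEnrichment.of V Y ⟶ ForgetEnrichment.of V Z) :
    ForgetEnrichment.homTo V g ≫ precomp f Z = ForgetEnrichment.homTo V (f ≫ g) := by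
  have key (f : 𝟙_ V ⟶ (X ⟶[V] Y)) (g : 𝟙_ V ⟶ (Y ⟶[V] Z)) :
      g ≫ (λ_ (Y ⟶[V] Z)).inv ≫ f ▷ _ ≫ eComp V X Y Z =
        ((λ_ _).inv ≫ (f ⊗ₘ g)) ≫ eComp V X Y Z := by
    rw [leftUnitor_inv_naturality_assoc, whisker_exchange_assoc,
      MonoidalCategory.tensorHom_def]
    simp only [Category.assoc]
  exact (key _ _).trans (ForgetEnrichment.homTo_comp V f g).symm

theorem homTo_comp_postcomp {X Y Z : D} (f : ForgetEnrichment.of V X ⟶ ForgetEnrichment.of V Y)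
    (g : ForgetEnrichment.of V Y ⟶ ForgetEnrichment.of V Z) :
    ForgetEnrichment.homTo V f ≫ postcomp X g = ForgetEnrichment.homTo V (f ≫ g) := by
  have key (f : 𝟙_ V ⟶ (X ⟶[V] Y)) (g : 𝟙_ V ⟶ (Y ⟶[V] Z)) :
      f ≫ (ρ_ (X ⟶[V] Y)).inv ≫ _ ◁ g ≫ eComp V X Y Z =
        ((λ_ _).inv ≫ (f ⊗ₘ g)) ≫ eComp V X Y Z := by
    rw [rightUnitor_inv_naturality_assoc, ← whisker_exchange_assoc,
      MonoidalCategory.tensorHom_def', unitors_inv_equal]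
    simp only [Category.assoc]
  exact (key _ _).trans (ForgetEnrichment.homTo_comp V f g).symm

instance isIso_postcomp (X : D) {Y Z : D}
    (g : ForgetEnrichment.of V Y ⟶ ForgetEnrichment.of V Z) [IsIso g] : IsIso (postcomp X g) :=
  ⟨postcomp X (inv g), by rw [← postcomp_comp, IsIso.hom_inv_id, postcomp_id],
    by rw [← postcomp_comp, IsIso.inv_hom_id, postcomp_id]⟩

instance isIso_precomp {X Y : D} (f : ForgetEnrichment.of V X ⟶ ForgetEnrichment.of V Y)
    [IsIso f] (Z : D) : IsIso (precomp f Z) :=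
  ⟨precomp (inv f) Z, by rw [← precomp_comp, IsIso.inv_hom_id, precomp_id],
    by rw [← precomp_comp, IsIso.hom_inv_id, precomp_id]⟩

/-- The enriched Yoneda lemma: a morphism is invertible if composition with it is. -/
theorem isIso_of_isIso_precomp {X Y : D}
    (f : ForgetEnrichment.of V X ⟶ ForgetEnrichment.of V Y) [∀ Z, IsIso (precomp f Z)] :
    IsIso f := by
  let g : ForgetEnrichment.of V Y ⟶ ForgetEnrichment.of V X :=
    ForgetEnrichment.homOf V (ForgetEnrichment.homTo V (𝟙 (ForgetEnrichment.of V X)) ≫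
      inv (precomp f X))
  have inj {Z : D} {h k : ForgetEnrichment.of V Y ⟶ ForgetEnrichment.of V Z}
      (e : f ≫ h = f ≫ k) : h = k := by
    have : ForgetEnrichment.homTo V h ≫ precomp f Z = ForgetEnrichment.homTo V k ≫ precomp f Z := by
      rw [homTo_comp_precomp, homTo_comp_precomp, e]
    exact (cancel_mono (precomp f Z)).1 this
  have h₁ : f ≫ g = 𝟙 _ := by
    have := homTo_comp_precomp f g
    rw [ForgetEnrichment.homTo_homOf, Category.assoc, IsIso.inv_hom_id, Category.comp_id] at this
    exact this.symm
  refine ⟨g, h₁, inj ?_⟩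
  rw [reassoc_of% h₁]
  exact (Category.comp_id f).symm

theorem EnrichedNatIso.map_postcomp {F G : EnrichedFunctor V D E} (α : EnrichedNatIso V F G)
    (X Y : D) : F.map X Y ≫ postcomp (F.obj X) (α.app Y).hom =
      G.map X Y ≫ precomp (α.app X).hom (G.obj Y) :=
  α.naturality X Y

section Inverse

variable {F : EnrichedFunctor V D E} {G : EnrichedFunctor V E D}

/-- The component `G (F X) ≅ X` of a natural isomorphism between `G ∘ F` and the identity. -/
def EnrichedNatIso.appIso (η : EnrichedNatIso V (F.comp V G) (EnrichedFunctor.id V D)) (X : D) :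
    ForgetEnrichment.of V (G.obj (F.obj X)) ≅ ForgetEnrichment.of V X :=
  η.app X

theorem EnrichedNatIso.map_map_postcomp
    (η : EnrichedNatIso V (F.comp V G) (EnrichedFunctor.id V D)) (X Y : D) :
    F.map X Y ≫ G.map _ _ ≫ postcomp (G.obj (F.obj X)) (η.appIso Y).hom =
      precomp (η.appIso X).hom Y :=
  (Category.assoc _ _ _).symm.trans ((η.map_postcomp X Y).trans (Category.id_comp _))

theorem EnrichedNatIso.isIso_map_map
    (η : EnrichedNatIso V (F.comp V G) (EnrichedFunctor.id V D)) (X Y : D) :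
    IsIso (F.map X Y ≫ G.map (F.obj X) (F.obj Y)) := by
  have h := η.map_map_postcomp X Y
  rw [← Category.assoc] at h
  have := isIso_precomp (η.appIso X).hom Y
  rw [← h] at this
  exact IsIso.of_isIso_comp_right _ (postcomp (G.obj (F.obj X)) (η.appIso Y).hom)

/-- One half of an equivalence of enriched categories is fully faithful. -/
theorem isIso_map_of_inverse (η : EnrichedNatIso V (F.comp V G) (EnrichedFunctor.id V D))
    (ε : EnrichedNatIso V (G.comp V F) (EnrichedFunctor.id V E)) (X Y : D) :
    IsIso (F.map X Y) := by
  have h₁ := η.isIso_map_map X Y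
  have h₂ := ε.isIso_map_map (F.obj X) (F.obj Y)
  -- the middle map is split on both sides
  have : IsSplitEpi (G.map (F.obj X) (F.obj Y)) :=
    ⟨⟨⟨inv (F.map X Y ≫ G.map (F.obj X) (F.obj Y)) ≫ F.map X Y, by simp⟩⟩⟩
  have : Mono (G.map (F.obj X) (F.obj Y)) :=
    mono_of_mono _ (F.map (G.obj (F.obj X)) (G.obj (F.obj Y)))
  have := isIso_of_mono_of_isSplitEpi (G.map (F.obj X) (F.obj Y))
  exact IsIso.of_isIso_comp_right _ (G.map (F.obj X) (F.obj Y))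

end Inverse

end Enriched

/-! ### Equivalences preserve tensors, compact generators and endomorphisms -/

section Tensor

variable {V : Type u} [Category.{v} V] [MonoidalCategory V] [MonoidalClosed V]
  {D : Type w₁} [EnrichedCategory V D] {E : Type w₂} [EnrichedCategory V E]

/-- `c : z ⟶ D(X, T)` exhibits `T` as a tensor of `z` and `X`. -/
def IsTensor {z : V} {X T : D} (c : z ⟶ (X ⟶[V] T)) : Prop :=
  ∀ Y, IsIso (tensorComparison V c Y)

theorem tensorComparison_postcomp {z : V} {X T : D} (c : z ⟶ (X ⟶[V] T)) {Y Z : D}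
    (g : ForgetEnrichment.of V Y ⟶ ForgetEnrichment.of V Z) :
    tensorComparison V c Y ≫ (ihom z).map (postcomp X g) =
      postcomp T g ≫ tensorComparison V c Z := by
  rw [tensorComparison, tensorComparison, ← curry_natural_right, ← curry_natural_left,
    Category.assoc, eComp_postcomp, whisker_exchange_assoc]

theorem tensorComparison_comp_postcomp {z : V} {X T T' : D} (c : z ⟶ (X ⟶[V] T))
    (g : ForgetEnrichment.of V T ⟶ ForgetEnrichment.of V T') (Y : D) :
    tensorComparison V (c ≫ postcomp X g) Y = precomp g Y ≫ tensorComparison V c Y := by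
  rw [tensorComparison, tensorComparison, ← curry_natural_left, comp_whiskerRight, Category.assoc,
    postcomp_eComp, whisker_exchange_assoc]

theorem map_tensorComparison (F : EnrichedFunctor V D E) {z : V} {X T : D} (c : z ⟶ (X ⟶[V] T))
    (Y : D) :
    F.map T Y ≫ tensorComparison V (c ≫ F.map X T) (F.obj Y) =
      tensorComparison V c Y ≫ (ihom z).map (F.map X Y) := by
  rw [tensorComparison, tensorComparison, ← curry_natural_right, ← curry_natural_left,
    Category.assoc, EnrichedFunctor.map_comp, MonoidalCategory.tensorHom_def', comp_whiskerRight]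
  simp only [Category.assoc]
  rw [whisker_exchange_assoc, whisker_exchange_assoc]

/-- Equivalences of enriched categories preserve tensors. -/
theorem IsTensor.map {F : EnrichedFunctor V D E} {G : EnrichedFunctor V E D}
    (η : EnrichedNatIso V (F.comp V G) (EnrichedFunctor.id V D))
    (ε : EnrichedNatIso V (G.comp V F) (EnrichedFunctor.id V E)) {z : V} {X T : D}
    {c : z ⟶ (X ⟶[V] T)} (hc : IsTensor c) : IsTensor (c ≫ F.map X T) := by
  intro Y
  have h₁ : IsIso (tensorComparison V (c ≫ F.map X T) (F.obj (G.obj Y))) := by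
    have := hc (G.obj Y)
    have := isIso_map_of_inverse η ε T (G.obj Y)
    have := isIso_map_of_inverse η ε X (G.obj Y)
    have : IsIso (F.map T (G.obj Y) ≫
        tensorComparison V (c ≫ F.map X T) (F.obj (G.obj Y))) := by
      rw [map_tensorComparison]
      infer_instance
    exact IsIso.of_isIso_comp_left (F.map T (G.obj Y)) _
  have : IsIso (postcomp (F.obj T) (ε.appIso Y).hom ≫ tensorComparison V (c ≫ F.map X T) Y) := by
    rw [← tensorComparison_postcomp]
    infer_instance
  exact IsIso.of_isIso_comp_left (postcomp (F.obj T) (ε.appIso Y).hom) _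

variable [Tensored V D] [Tensored V E]

theorem coev_postcomp_desc {z : V} {X Y : D} (f : z ⟶ (X ⟶[V] Y)) :
    Tensored.coev z X ≫ postcomp X (Tensored.desc V f) = f := by
  have key (g : 𝟙_ V ⟶ (Tensored.obj z X ⟶[V] Y))
      (hg : g ≫ tensorComparison V (Tensored.coev z X) Y = curry ((ρ_ z).hom ≫ f)) :
      Tensored.coev z X ≫ (ρ_ _).inv ≫ _ ◁ g ≫ eComp V X (Tensored.obj z X) Y = f := by
    rw [tensorComparison, ← curry_natural_left] at hg
    have := curry_injective hg
    rw [rightUnitor_inv_naturality_assoc, ← whisker_exchange_assoc, this, Iso.inv_hom_id_assoc]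
  apply key
  rw [Tensored.desc, ForgetEnrichment.homTo_homOf, Category.assoc, IsIso.inv_hom_id,
    Category.comp_id]

/-- The tensorial strength of a functor is invertible if the functor maps the unit of the tensor
to the unit of a tensor. -/
theorem isIso_strength (F : EnrichedFunctor V D E) (z : V) (X : D)
    (h : IsTensor (Tensored.coev z X ≫ F.map X (Tensored.obj z X))) :
    IsIso (strength V F z X) := by
  have (Y : E) : IsIso (precomp (strength V F z X) Y) := by
    have h₁ := h Y
    change IsIso (precomp (Tensored.desc V (Tensored.coev z X ≫ F.map X (Tensored.obj z X))) Y)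
    rw [← coev_postcomp_desc (Tensored.coev z X ≫ F.map X (Tensored.obj z X)),
      tensorComparison_comp_postcomp] at h₁
    exact IsIso.of_isIso_comp_right _ (tensorComparison V (Tensored.coev z (F.obj X)) Y)
  exact isIso_of_isIso_precomp (strength V F z X)

end Tensor

section Transpose

variable {V : Type u} [Category.{v} V] [MonoidalCategory V] {D : Type w₁} [EnrichedCategory V D]
  {E : Type w₂} [EnrichedCategory V E]

/-- A `V`-natural isomorphism is natural on the underlying categories. -/
def EnrichedNatIso.forgetIso {F G : EnrichedFunctor V D E} (α : EnrichedNatIso V F G) :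
    F.forget ≅ G.forget :=
  NatIso.ofComponents (fun X => α.app (ForgetEnrichment.to V X)) (fun {X Y} f => by
    have h₁ := homTo_comp_postcomp (F.forget.map f) (α.app (ForgetEnrichment.to V Y)).hom
    have h₂ := homTo_comp_precomp (α.app (ForgetEnrichment.to V X)).hom (G.forget.map f)
    refine h₁.symm.trans (Eq.trans ?_ h₂)
    refine (Category.assoc _ _ _).trans (Eq.trans ?_ (Category.assoc _ _ _).symm)
    exact congrArg (_ ≫ ·) (α.map_postcomp _ _))

variable {F : EnrichedFunctor V D E} {G : EnrichedFunctor V E D}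

theorem isEquivalence_forget (η : EnrichedNatIso V (F.comp V G) (EnrichedFunctor.id V D))
    (ε : EnrichedNatIso V (G.comp V F) (EnrichedFunctor.id V E)) : G.forget.IsEquivalence :=
  (CategoryTheory.Equivalence.mk G.forget F.forget
    ((EnrichedFunctor.forgetId V E).symm ≪≫ ε.forgetIso.symm ≪≫ EnrichedFunctor.forgetComp G F)
    ((EnrichedFunctor.forgetComp F G).symm ≪≫ η.forgetIso ≪≫
      EnrichedFunctor.forgetId V D)).isEquivalence_functor

/-- Mutually inverse enriched functors are adjoint: `D(X, G Y) ≅ E(F X, Y)`. -/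
def transpose (ε : EnrichedNatIso V (G.comp V F) (EnrichedFunctor.id V E)) (X : D) (Y : E) :
    (X ⟶[V] G.obj Y) ⟶ (F.obj X ⟶[V] Y) :=
  F.map X (G.obj Y) ≫ postcomp (F.obj X) (ε.appIso Y).hom

theorem isIso_transpose (η : EnrichedNatIso V (F.comp V G) (EnrichedFunctor.id V D))
    (ε : EnrichedNatIso V (G.comp V F) (EnrichedFunctor.id V E)) (X : D) (Y : E) :
    IsIso (transpose ε X Y) := by
  have := isIso_map_of_inverse η ε X (G.obj Y)
  exact inferInstanceAs (IsIso (_ ≫ _))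

variable (ε : EnrichedNatIso V (G.comp V F) (EnrichedFunctor.id V E))

theorem eComp_transpose (X : D) (Y Z : E) :
    _ ◁ G.map Y Z ≫ eComp V X (G.obj Y) (G.obj Z) ≫ transpose ε X Z =
      transpose ε X Y ▷ _ ≫ eComp V (F.obj X) Y Z := by
  simp only [transpose, comp_whiskerRight, Category.assoc, EnrichedFunctor.map_comp_assoc]
  rw [postcomp_eComp, eComp_postcomp, ← ε.map_map_postcomp,
    MonoidalCategory.tensorHom_def_assoc, whisker_exchange_assoc]
  simp only [MonoidalCategory.whiskerLeft_comp, Category.assoc]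

theorem postcomp_transpose (X : D) {Y Z : E}
    (f : ForgetEnrichment.of V Y ⟶ ForgetEnrichment.of V Z) :
    postcomp X (G.forget.map f) ≫ transpose ε X Z =
      transpose ε X Y ≫ postcomp (F.obj X) f := by
  have key (f : 𝟙_ V ⟶ (Y ⟶[V] Z)) :
      ((ρ_ _).inv ≫ _ ◁ (f ≫ G.map Y Z) ≫ eComp V X (G.obj Y) (G.obj Z)) ≫ transpose ε X Z =
        transpose ε X Y ≫ (ρ_ _).inv ≫ _ ◁ f ≫ eComp V (F.obj X) Y Z := by
    simp only [MonoidalCategory.whiskerLeft_comp, Category.assoc]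
    rw [eComp_transpose, rightUnitor_inv_naturality_assoc, whisker_exchange_assoc]
  exact key _

end Transpose

section CompactGenerator

variable {V : Type u} [Category.{v} V] [MonoidalCategory V] [SymmetricCategory V]
  [MonoidalClosed V] {D : Type w₁} [EnrichedCategory V D] {E : Type w₂} [EnrichedCategory V E]
  {F : EnrichedFunctor V D E} {G : EnrichedFunctor V E D}

/-- Mutually inverse enriched functors give an isomorphism between the ordinary functors
`D(X, G -)` and `E(F X, -)`. -/
def homToBaseObjIso (η : EnrichedNatIso V (F.comp V G) (EnrichedFunctor.id V D))
    (ε : EnrichedNatIso V (G.comp V F) (EnrichedFunctor.id V E)) (X : D) :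
    G.forget ⋙ homToBase (V := V) X ≅ homToBase (V := V) (F.obj X) :=
  NatIso.ofComponents
    (fun Y => @asIso _ _ _ _ (transpose ε X (ForgetEnrichment.to V Y))
      (isIso_transpose η ε X (ForgetEnrichment.to V Y)))
    (fun {Y Z} f => by
      have h₁ := equivFunctor_map_homFunctor X (G.forget.map f)
      have h₂ := equivFunctor_map_homFunctor (F.obj X) f
      exact (congrArg (· ≫ _) h₁).trans
        ((postcomp_transpose ε X f).trans (congrArg (_ ≫ ·) h₂).symm))

theorem homTensorStrength_transpose [Tensored V D] [Tensored V E]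
    (ε : EnrichedNatIso V (G.comp V F) (EnrichedFunctor.id V E)) (z : V) (X : D) (Y : E) :
    z ◁ transpose ε X Y ≫ homTensorStrength z (F.obj X) Y =
      homTensorStrength z X (G.obj Y) ≫ postcomp X (strength V G z Y) ≫
        transpose ε X (Tensored.obj z Y) := by
  have h := coev_postcomp_desc (Tensored.coev z Y ≫ G.map Y (Tensored.obj z Y))
  simp only [homTensorStrength, Category.assoc]
  rw [reassoc_of% eComp_postcomp, ← MonoidalCategory.whiskerLeft_comp_assoc]
  erw [h]
  rw [BraidedCategory.braiding_naturality_right_assoc, ← whisker_exchange_assoc,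
    ← eComp_transpose, MonoidalCategory.whiskerLeft_comp_assoc]

/-- An equivalence of enriched categories preserves compact generators. -/
theorem IsCompactGenerator.map [Tensored V D] [Tensored V E]
    (η : EnrichedNatIso V (F.comp V G) (EnrichedFunctor.id V D))
    (ε : EnrichedNatIso V (G.comp V F) (EnrichedFunctor.id V E)) {X : D}
    (hX : IsCompactGenerator V X) : IsCompactGenerator V (F.obj X) := by
  obtain ⟨h₁, h₂, h₃⟩ := (isCompactGenerator_iff X).1 hX
  have := isEquivalence_forget η ε
  refine (isCompactGenerator_iff _).2 ⟨fun z Y => ?_,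
    preservesColimitsOfShape_of_natIso (homToBaseObjIso η ε X),
    reflectsIsomorphisms_of_iso (homToBaseObjIso η ε X)⟩
  have hs : IsIso (strength V G z Y) :=
    isIso_strength G z Y (IsTensor.map ε η fun W => Tensored.isIso_comparison z Y W)
  have := h₁ z (G.obj Y)
  have := isIso_transpose η ε X Y
  have := isIso_transpose η ε X (Tensored.obj z Y)
  have := isIso_postcomp X (Y := Tensored.obj z (G.obj Y)) (Z := G.obj (Tensored.obj z Y))
    (strength V G z Y)
  have : IsIso (z ◁ transpose ε X Y ≫ homTensorStrength z (F.obj X) Y) := by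
    rw [homTensorStrength_transpose]
    infer_instance
  exact IsIso.of_isIso_comp_left (z ◁ transpose ε X Y) _

/-- A fully faithful enriched functor preserves endomorphism monoids. -/
def endMonIso (F : EnrichedFunctor V D E) (X : D) [hF : IsIso (F.map X X)] :
    endMon V X ≅ endMon V (F.obj X) :=
  Mon.mkIso (M := endMon V X) (N := endMon V (F.obj X))
    (@asIso _ _ (X ⟶[V] X) _ (F.map X X) hF) (F.map_id X) (by
    change ((β_ _ _).hom ≫ eComp V X X X) ≫ F.map X X =
      (F.map X X ⊗ₘ F.map X X) ≫ (β_ _ _).hom ≫ eComp V _ _ _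
    rw [Category.assoc, F.map_comp, BraidedCategory.braiding_naturality_assoc])

end CompactGenerator

/-! ### Coequalizers mapped by Hom out of a compact generator -/

namespace RightMod

/-- Two coequalizers of the same pair of morphisms are related by an isomorphism. -/
theorem isIso_of_isColimit_cofork {C : Type u} [Category.{v} C] {X Y Z W : C} {f g : X ⟶ Y}
    {q : Y ⟶ Z} {r : Y ⟶ W}
    {wq : f ≫ q = g ≫ q} {wr : f ≫ r = g ≫ r} (hq : IsColimit (Cofork.ofπ q wq))
    (hr : IsColimit (Cofork.ofπ r wr)) (k : Z ⟶ W) (hk : q ≫ k = r) : IsIso k := by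
  have : k = (hq.coconePointUniqueUpToIso hr).hom := by
    apply Cofork.IsColimit.hom_ext hq
    refine hk.trans ?_
    exact (IsColimit.comp_coconePointUniqueUpToIso_hom hq hr WalkingParallelPair.one).symm
  rw [this]
  infer_instance

variable {C : Type u} [Category.{v} C] [MonoidalCategory C]

/-- The action `M ⊗ b ⟶ M` is a coequalizer of `M ⊗ b ⊗ b ⇉ M ⊗ b`, split by the unit of `b`. -/
def actIsColimit {b : Mon C} (M : RightMod b) :
    IsColimit (Cofork.ofπ (f := M.act ▷ b.X) (g := (α_ _ _ _).hom ≫ M.X ◁ MonObj.mul) M.act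
      (by rw [Category.assoc, M.act_mul, Iso.hom_inv_id_assoc])) :=
  IsSplitCoequalizer.isCoequalizer
    { rightSection := (ρ_ _).inv ≫ M.X ◁ MonObj.one
      leftSection := (ρ_ _).inv ≫ _ ◁ MonObj.one
      condition := by rw [Category.assoc, M.act_mul, Iso.hom_inv_id_assoc]
      rightSection_π := by rw [Category.assoc, M.act_one, Iso.inv_hom_id]
      leftSection_bottom := by
        rw [Category.assoc, associator_naturality_right_assoc, ← MonoidalCategory.whiskerLeft_comp,
          MonObj.mul_one]
        simp
      leftSection_top := by
        rw [Category.assoc, whisker_exchange, rightUnitor_inv_naturality_assoc] }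

variable [SymmetricCategory C] [MonoidalClosed C] [HasEqualizers C] {b b' : Mon C}

theorem homToBase_map_ofLinear (x : RightMod b) {y z : RightMod b} (f : y.X ⟶ z.X)
    (hf : f ▷ b.X ≫ z.act = y.act ≫ f) :
    (homToBase (V := C) x).map (ofLinear f hf) = homMap x f hf := by
  refine (homFunctor_map x (ofLinear f hf)).trans (hom_ext_apply ?_)
  exact (homMap_apply x (y := y) (z := z) _ _).trans
    ((congrArg (_ ≫ ·) (underlying_map_ofLinear f hf)).trans (homMap_apply x f hf).symm)

/-- If Hom out of `x` preserves coequalizers, it maps a coequalizer of linear maps in the base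
category to a coequalizer, in whatever form `A`, `B` the two Hom objects are given. -/
theorem nonempty_isColimit_homMap {x : RightMod b}
    [PreservesColimitsOfShape WalkingParallelPair (homToBase (V := C) x)]
    {P Q T : RightMod b} {f g : P.X ⟶ Q.X} {q : Q.X ⟶ T.X}
    {hf : f ▷ b.X ≫ Q.act = P.act ≫ f} {hg : g ▷ b.X ≫ Q.act = P.act ≫ g}
    {hq : q ▷ b.X ≫ T.act = Q.act ≫ q} {w : f ≫ q = g ≫ q} (l : IsColimit (Cofork.ofπ q w))
    {A B : C} {f' g' : A ⟶ B} (s : A ⟶ hom x P) (t : B ⟶ hom x Q) [IsIso s] [IsIso t]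
    (h₁ : f' ≫ t = s ≫ homMap x f hf) (h₂ : g' ≫ t = s ≫ homMap x g hg) :
    ∃ w' : f' ≫ t ≫ homMap x q hq = g' ≫ t ≫ homMap x q hq,
      Nonempty (IsColimit (Cofork.ofπ (t ≫ homMap x q hq) w')) := by
  let f₀ := ofLinear f hf
  let g₀ := ofLinear g hg
  let q₀ := ofLinear q hq
  have w₀ : f₀ ≫ q₀ = g₀ ≫ q₀ := by
    apply (underlying b).map_injective
    rw [Functor.map_comp, Functor.map_comp, underlying_map_ofLinear, underlying_map_ofLinear,
      underlying_map_ofLinear]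
    exact w
  have l₀ : IsColimit (Cofork.ofπ ((underlying b).map q₀)
      (by rw [← Functor.map_comp, w₀, Functor.map_comp]) :
        Cofork ((underlying b).map f₀) ((underlying b).map g₀)) :=
    Cofork.isColimitOfIsos _ l _ (Iso.refl P.X) (Iso.refl Q.X) (Iso.refl T.X)
      ((Category.id_comp _).trans ((underlying_map_ofLinear f hf).trans (Category.comp_id _).symm))
      ((Category.id_comp _).trans ((underlying_map_ofLinear g hg).trans (Category.comp_id _).symm))
      ((Category.id_comp _).trans
        ((Category.comp_id _).trans (underlying_map_ofLinear q hq).symm))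
  obtain ⟨l₁⟩ := nonempty_isColimit_of_underlying w₀ l₀
  have l₂ := isColimitCoforkMapOfIsColimit (homToBase (V := C) x) w₀ l₁
  have w' : f' ≫ t ≫ homMap x q hq = g' ≫ t ≫ homMap x q hq := by
    have e := (homToBase (V := C) x).congr_map w₀
    rw [Functor.map_comp, Functor.map_comp, homToBase_map_ofLinear, homToBase_map_ofLinear,
      homToBase_map_ofLinear] at e
    rw [reassoc_of% h₁, reassoc_of% h₂]
    exact congrArg (s ≫ ·) e
  have comm {k : hom x P ⟶ hom x Q} {k' : A ⟶ B} (h : k' ≫ t = s ≫ k) :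
      inv s ≫ k' = k ≫ inv t := by
    rw [IsIso.inv_comp_eq, ← Category.assoc, IsIso.eq_comp_inv, h]
  exact ⟨w', ⟨Cofork.isColimitOfIsos _ l₂ _ (asIso s).symm (asIso t).symm (Iso.refl _)
    ((comm h₁).trans (congrArg (· ≫ _) (homToBase_map_ofLinear x f hf).symm))
    ((comm h₂).trans (congrArg (· ≫ _) (homToBase_map_ofLinear x g hg).symm))
    (congrArg (t ≫ ·) ((Category.comp_id _).trans (homToBase_map_ofLinear x q hq)))⟩⟩

/-! ### A module and its dual as bimodules over the endomorphisms -/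

section EndomorphismAction

variable (x : RightMod b') (φ : b ≅ endMon C x)

/-- The isomorphism `b ≅ Hom(x, x)` of objects underlying an isomorphism of monoids. -/
def endIso : b.X ≅ hom x x :=
  (Mon.forget C).mapIso φ

/-- The left action of `b` on `x` through an isomorphism of `b` with the endomorphisms of `x`. -/
def endAct : b.X ⊗ x.X ⟶ x.X :=
  (endIso x φ).hom ▷ x.X ≫ homApply x x

theorem one_endAct : MonObj.one ▷ x.X ≫ endAct x φ = (λ_ x.X).hom := by
  have h : MonObj.one ≫ (endIso x φ).hom = homId x := IsMonHom.one_hom (f := φ.hom.hom)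
  rw [endAct, ← comp_whiskerRight_assoc, h, homId_apply]

theorem mul_endAct : MonObj.mul ▷ x.X ≫ endAct x φ =
    (α_ b.X b.X x.X).hom ≫ b.X ◁ endAct x φ ≫ endAct x φ := by
  have h : MonObj.mul ≫ (endIso x φ).hom =
    ((endIso x φ).hom ⊗ₘ (endIso x φ).hom) ≫ (MonObj.mul (X := (endMon C x).X)) :=
      IsMonHom.mul_hom (f := φ.hom.hom)
  rw [endAct, ← comp_whiskerRight_assoc, h]
  exact tensorHom_mul_apply _ _ _ _ rfl (endMon_mul_apply x)

theorem endAct_linear : endAct x φ ▷ b'.X ≫ x.act =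
    (α_ b.X x.X b'.X).hom ≫ b.X ◁ x.act ≫ endAct x φ := by
  rw [endAct, comp_whiskerRight_assoc, homApply_linear, associator_naturality_left_assoc,
    ← whisker_exchange_assoc]

/-- A right module as a bimodule over its endomorphism monoid. -/
def endBimod : Bimod b b' where
  X := x.X
  actLeft := endAct x φ
  actRight := x.act
  one_actLeft := one_endAct x φ
  left_assoc := mul_endAct x φ
  actRight_one := x.act_one
  right_assoc := x.act_mul
  middle_assoc := endAct_linear x φ

/-- Application `Hom(x, b') ⊗ x ⟶ b'` of linear forms on `x`. -/
def dualApply : hom x (regular b') ⊗ x.X ⟶ b'.X :=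
  homApply x (regular b')

theorem dualApply_linear : dualApply x ▷ b'.X ≫ MonObj.mul =
    (α_ _ _ _).hom ≫ _ ◁ x.act ≫ dualApply x :=
  homApply_linear x (regular b')

theorem dual_ext {x : RightMod b'} {w : C} {f g : w ⟶ hom x (regular b')}
    (h : f ▷ x.X ≫ dualApply x = g ▷ x.X ≫ dualApply x) : f = g :=
  hom_ext_apply h

/-- Multiplication of linear forms by elements of `b'` on the left. -/
def dualActLeft : b'.X ⊗ hom x (regular b') ⟶ hom x (regular b') :=
  homCurry (x := x) (y := regular b') ((α_ _ _ _).hom ≫ b'.X ◁ dualApply x ≫ MonObj.mul) (by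
    have h : ((α_ _ _ _).hom ≫ b'.X ◁ dualApply x ≫ MonObj.mul) ▷ b'.X ≫ MonObj.mul =
        (α_ _ _ _).hom ≫ _ ◁ x.act ≫ (α_ _ _ _).hom ≫ b'.X ◁ dualApply x ≫ MonObj.mul := by
      simp only [comp_whiskerRight, Category.assoc, MonObj.mul_assoc, whisker_assoc]
      rw [Iso.inv_hom_id_assoc, ← MonoidalCategory.whiskerLeft_comp_assoc, dualApply_linear]
      simp
    exact h)

theorem dualActLeft_apply : dualActLeft x ▷ x.X ≫ dualApply x =
    (α_ _ _ _).hom ≫ b'.X ◁ dualApply x ≫ MonObj.mul :=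
  homCurry_apply (x := x) (y := regular b') _ _

/-- Precomposition of linear forms with the action of `b` on `x`. -/
def dualActRight : hom x (regular b') ⊗ b.X ⟶ hom x (regular b') :=
  homCurry (x := x) (y := regular b') ((α_ _ _ _).hom ≫ _ ◁ endAct x φ ≫ dualApply x) (by
    have h : ((α_ _ _ _).hom ≫ _ ◁ endAct x φ ≫ dualApply x) ▷ b'.X ≫ MonObj.mul =
        (α_ _ _ _).hom ≫ _ ◁ x.act ≫ (α_ _ _ _).hom ≫ _ ◁ endAct x φ ≫ dualApply x := by
      simp only [comp_whiskerRight, Category.assoc, whisker_assoc]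
      rw [dualApply_linear, Iso.inv_hom_id_assoc, ← MonoidalCategory.whiskerLeft_comp_assoc,
        endAct_linear]
      simp
    exact h)

theorem dualActRight_apply : dualActRight x φ ▷ x.X ≫ dualApply x =
    (α_ _ _ _).hom ≫ _ ◁ endAct x φ ≫ dualApply x :=
  homCurry_apply (x := x) (y := regular b') _ _

/-- The dual `Hom(x, b')` of a module as a bimodule. -/
def dualBimod : Bimod b' b where
  X := hom x (regular b')
  actLeft := dualActLeft x
  actRight := dualActRight x φ
  one_actLeft := by
    apply dual_ext
    rw [comp_whiskerRight, Category.assoc, dualActLeft_apply,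
      associator_naturality_left_assoc, ← whisker_exchange_assoc, MonObj.one_mul]
    simp
  left_assoc := by
    apply dual_ext
    rw [comp_whiskerRight, Category.assoc, dualActLeft_apply,
      associator_naturality_left_assoc, ← whisker_exchange_assoc, MonObj.mul_assoc]
    simp only [comp_whiskerRight, Category.assoc, dualActLeft_apply]
    rw [associator_naturality_middle_assoc, ← MonoidalCategory.whiskerLeft_comp_assoc _ (_ ▷ _),
      dualActLeft_apply]
    simp
  actRight_one := by
    apply dual_ext
    rw [comp_whiskerRight, Category.assoc, dualActRight_apply,
      associator_naturality_middle_assoc, ← MonoidalCategory.whiskerLeft_comp_assoc, one_endAct]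
    simp
  right_assoc := by
    apply dual_ext
    simp only [comp_whiskerRight, Category.assoc, dualActRight_apply]
    rw [associator_naturality_middle_assoc, ← MonoidalCategory.whiskerLeft_comp_assoc, mul_endAct,
      associator_naturality_left_assoc, ← whisker_exchange_assoc, dualActRight_apply]
    simp
  middle_assoc := by
    apply dual_ext
    simp only [comp_whiskerRight, Category.assoc, dualActRight_apply, dualActLeft_apply]
    rw [associator_naturality_left_assoc, ← whisker_exchange_assoc, dualActLeft_apply,
      associator_naturality_middle_assoc, ← MonoidalCategory.whiskerLeft_comp_assoc _ (_ ▷ _),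
      dualActRight_apply]
    simp

end EndomorphismAction

end RightMod

/-! ### Tensor products of bimodules -/

section TensorBimod

variable {C : Type u} [Category.{v} C] [MonoidalCategory C] {r s t : Mon C}

/-- The right module underlying a bimodule. -/
def toRightMod (M : Bimod r s) : RightMod s where
  X := M.X
  act := M.actRight
  act_one := M.actRight_one
  act_mul := M.right_assoc

variable [SymmetricCategory C] [MonoidalClosed C] [HasCoequalizers C]
  (M : Bimod r s) (N : Bimod s t)

/-- The projection `M ⊗ N ⟶ M ⊛ N` to the tensor product of bimodules. -/
def tensorπ : M.X ⊗ N.X ⟶ (M.tensorBimod N).X :=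
  coequalizer.π (M.actRight ▷ N.X) ((α_ _ _ _).hom ≫ M.X ◁ N.actLeft)

theorem tensorπ_condition : M.actRight ▷ N.X ≫ tensorπ M N =
    ((α_ _ _ _).hom ≫ M.X ◁ N.actLeft) ≫ tensorπ M N :=
  coequalizer.condition (M.actRight ▷ N.X) ((α_ _ _ _).hom ≫ M.X ◁ N.actLeft)

/-- The tensor product of bimodules is a coequalizer. -/
def tensorπIsColimit : IsColimit (Cofork.ofπ (tensorπ M N) (tensorπ_condition M N)) :=
  coequalizerIsCoequalizer _ _

instance : Epi (tensorπ M N) :=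
  inferInstanceAs (Epi (coequalizer.π (M.actRight ▷ N.X) ((α_ _ _ _).hom ≫ M.X ◁ N.actLeft)))

theorem whiskerLeft_tensorπ_actLeft : r.X ◁ tensorπ M N ≫ (M.tensorBimod N).actLeft =
    (α_ _ _ _).inv ≫ M.actLeft ▷ N.X ≫ tensorπ M N :=
  Bimod.TensorBimod.whiskerLeft_π_actLeft M N

theorem tensorπ_whiskerRight_actRight : tensorπ M N ▷ t.X ≫ (M.tensorBimod N).actRight =
    (α_ _ _ _).hom ≫ M.X ◁ N.actRight ≫ tensorπ M N :=
  Bimod.TensorBimod.π_tensor_id_actRight M N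

/-- A balanced map `q : M ⊗ N ⟶ K` of bimodules exhibits `K` as the tensor product when the map
`k : M ⊛ N ⟶ K` through which it factors is invertible. -/
def tensorBimodIso {K : Bimod r t} (q : M.X ⊗ N.X ⟶ K.X)
    (hl : M.actLeft ▷ N.X ≫ q = (α_ _ _ _).hom ≫ r.X ◁ q ≫ K.actLeft)
    (hr : q ▷ t.X ≫ K.actRight = (α_ _ _ _).hom ≫ M.X ◁ N.actRight ≫ q)
    (k : (M.tensorBimod N).X ⟶ K.X) (hk : tensorπ M N ≫ k = q) (hi : IsIso k) :
    M.tensorBimod N ≅ K :=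
  Bimod.isoOfIso (asIso k)
    (by
      rw [← cancel_epi (r.X ◁ tensorπ M N)]
      have h := whiskerLeft_tensorπ_actLeft M N
      rw [reassoc_of% h, ← MonoidalCategory.whiskerLeft_comp_assoc]
      change (α_ _ _ _).inv ≫ M.actLeft ▷ N.X ≫ tensorπ M N ≫ k = r.X ◁ (_ ≫ k) ≫ K.actLeft
      rw [hk, hl, Iso.inv_hom_id_assoc])
    (by
      rw [← cancel_epi (tensorπ M N ▷ t.X)]
      have h := tensorπ_whiskerRight_actRight M N
      rw [reassoc_of% h, ← comp_whiskerRight_assoc]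
      change (α_ _ _ _).hom ≫ M.X ◁ N.actRight ≫ tensorπ M N ≫ k = (_ ≫ k) ▷ t.X ≫ K.actRight
      rw [hk, hr])

end TensorBimod

/-! ### A compact generator is an invertible bimodule -/

namespace RightMod

section Tensor

variable {C : Type u} [Category.{v} C] [MonoidalCategory C] {b : Mon C}

/-- The map `z ⊛ y ⟶ z' ⊛ y` induced by `d : z ⟶ z'`. -/
def tensorMap {z z' : C} (d : z ⟶ z') (y : RightMod b) : (tensor z y).X ⟶ (tensor z' y).X :=
  d ▷ y.X

theorem tensorMap_linear {z z' : C} (d : z ⟶ z') (y : RightMod b) :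
    tensorMap d y ▷ b.X ≫ (tensor z' y).act = (tensor z y).act ≫ tensorMap d y := by
  have h : (d ▷ y.X) ▷ b.X ≫ (α_ _ _ _).hom ≫ z' ◁ y.act =
      ((α_ _ _ _).hom ≫ z ◁ y.act) ≫ d ▷ y.X := by
    rw [associator_naturality_left_assoc, ← whisker_exchange, Category.assoc]
  exact h

/-- The map `(z ⊗ c) ⊛ y ⟶ z ⊛ y'` induced by `k : c ⊛ y ⟶ y'`. -/
def tensorFold (z : C) {c : C} {y y' : RightMod b} (k : c ⊗ y.X ⟶ y'.X) :
    (tensor (z ⊗ c) y).X ⟶ (tensor z y').X :=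
  (α_ z c y.X).hom ≫ z ◁ k

theorem tensorFold_linear (z : C) {c : C} {y y' : RightMod b} (k : c ⊗ y.X ⟶ y'.X)
    (hk : IsLinearFamily y y' k) :
    tensorFold z k ▷ b.X ≫ (tensor z y').act = (tensor (z ⊗ c) y).act ≫ tensorFold z k := by
  have h : ((α_ z c y.X).hom ≫ z ◁ k) ▷ b.X ≫ (α_ _ _ _).hom ≫ z ◁ y'.act =
      ((α_ _ _ _).hom ≫ (z ⊗ c) ◁ y.act) ≫ (α_ z c y.X).hom ≫ z ◁ k := by
    simp only [comp_whiskerRight, Category.assoc, whisker_assoc]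
    rw [Iso.inv_hom_id_assoc, ← MonoidalCategory.whiskerLeft_comp, hk]
    simp
  exact h

end Tensor

variable {C : Type u} [Category.{v} C] [MonoidalCategory C] [SymmetricCategory C]
  [MonoidalClosed C] [HasEqualizers C] {b b' : Mon C}

theorem isIso_homStrength {x : RightMod b} (hx : IsCompactGenerator C x) (z : C)
    (y : RightMod b) : IsIso (homStrength z x y) := by
  rw [homStrength_eq]
  exact ((isCompactGenerator_iff x).1 hx).1 z y

/-- A linear map is invertible if the map induced on Hom out of a compact generator is. -/
theorem isIso_of_isIso_homMap {x : RightMod b} (hx : IsCompactGenerator C x) {y z : RightMod b}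
    (f : y.X ⟶ z.X) (hf : f ▷ b.X ≫ z.act = y.act ≫ f) [h : IsIso (homMap x f hf)] :
    IsIso f := by
  have := ((isCompactGenerator_iff x).1 hx).2.2
  have : IsIso ((homToBase (V := C) x).map (ofLinear f hf)) := by
    rw [homToBase_map_ofLinear]
    exact h
  have : IsIso (ofLinear f hf) := isIso_of_reflects_iso _ (homToBase (V := C) x)
  have h' : IsIso ((underlying b).map (ofLinear f hf)) := inferInstance
  rw [underlying_map_ofLinear] at h'
  exact h'

theorem comp_apply {x y : RightMod b} {w w' : C} (u : w' ⟶ w) (v : w ⟶ hom x y)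
    {k : w ⊗ x.X ⟶ y.X} (h : v ▷ x.X ≫ homApply x y = k) :
    (u ≫ v) ▷ x.X ≫ homApply x y = u ▷ x.X ≫ k := by
  rw [comp_whiskerRight, Category.assoc, h]

theorem comp_homMap_apply {x y y' : RightMod b} {w : C} (u : w ⟶ hom x y)
    {k : w ⊗ x.X ⟶ y.X} (h : u ▷ x.X ≫ homApply x y = k) (f : y.X ⟶ y'.X)
    (hf : f ▷ b.X ≫ y'.act = y.act ≫ f) :
    (u ≫ homMap x f hf) ▷ x.X ≫ homApply x y' = k ≫ f := by
  rw [comp_whiskerRight, Category.assoc, homMap_apply, ← h, Category.assoc]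

theorem homStrength_naturality {z z' : C} (d : z ⟶ z') (x y : RightMod b) :
    d ▷ hom x y ≫ homStrength z' x y =
      homStrength z x y ≫ homMap x (tensorMap d y) (tensorMap_linear d y) := by
  apply hom_ext_apply
  have h : (d ▷ hom x y) ▷ x.X ≫ (α_ _ _ _).hom ≫ z' ◁ homApply x y =
      ((α_ _ _ _).hom ≫ z ◁ homApply x y) ≫ d ▷ y.X := by
    rw [associator_naturality_left_assoc, ← whisker_exchange, Category.assoc]
  exact (comp_apply _ _ (homStrength_apply z' x y)).trans
    (h.trans (comp_homMap_apply _ (homStrength_apply z x y) (tensorMap d y) _).symm)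

/-- Compatibility of the tensorial strength with a linear family `k : c ⊗ y ⟶ y'`; here `k'` is
composition with `k`. -/
theorem homStrength_tensorFold (z : C) {c : C} {x y y' : RightMod b} (k : c ⊗ y.X ⟶ y'.X)
    (hk : IsLinearFamily y y' k) (k' : c ⊗ hom x y ⟶ hom x y')
    (hk' : k' ▷ x.X ≫ homApply x y' = (α_ _ _ _).hom ≫ c ◁ homApply x y ≫ k) :
    ((α_ _ _ _).hom ≫ z ◁ k') ≫ homStrength z x y' =
      homStrength (z ⊗ c) x y ≫ homMap x (tensorFold z k) (tensorFold_linear z k hk) := by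
  apply hom_ext_apply
  have h : ((α_ _ _ _).hom ≫ z ◁ k') ▷ x.X ≫ (α_ _ _ _).hom ≫ z ◁ homApply x y' =
      ((α_ _ _ _).hom ≫ (z ⊗ c) ◁ homApply x y) ≫ (α_ z c y.X).hom ≫ z ◁ k := by
    simp only [comp_whiskerRight, Category.assoc, whisker_assoc]
    rw [Iso.inv_hom_id_assoc, ← MonoidalCategory.whiskerLeft_comp, hk']
    simp
  exact (comp_apply _ _ (homStrength_apply z x y')).trans
    (h.trans (comp_homMap_apply _ (homStrength_apply (z ⊗ c) x y) (tensorFold z k) _).symm)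

/-- The product of the endomorphism monoid, as a morphism between Hom objects. -/
def endMul (x : RightMod b) : hom x x ⊗ hom x x ⟶ hom x x :=
  MonObj.mul (X := (endMon C x).X)

theorem endMul_apply (x : RightMod b) : endMul x ▷ x.X ≫ homApply x x =
    (α_ _ _ _).hom ≫ hom x x ◁ homApply x x ≫ homApply x x :=
  endMon_mul_apply x

variable {x : RightMod b'} (φ : b ≅ endMon C x)

theorem mul_endIso : MonObj.mul ≫ (endIso x φ).hom =
    ((endIso x φ).hom ⊗ₘ (endIso x φ).hom) ≫
      endMul x :=
  IsMonHom.mul_hom (f := φ.hom.hom)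

/-- Composition with the action of `b` on `x`, as a map on endomorphisms of `x`. -/
def endComp (x : RightMod b') (φ : b ≅ endMon C x) : b.X ⊗ hom x x ⟶ hom x x :=
  (endIso x φ).hom ▷ hom x x ≫ endMul x

theorem endComp_apply : endComp x φ ▷ x.X ≫ homApply x x =
    (α_ _ _ _).hom ≫ b.X ◁ homApply x x ≫ endAct x φ := by
  rw [endComp, comp_whiskerRight, Category.assoc, endMul_apply,
    associator_naturality_left_assoc, ← whisker_exchange_assoc, endAct]

theorem whiskerLeft_endIso_endComp :
    b.X ◁ (endIso x φ).hom ≫ endComp x φ = MonObj.mul ≫ (endIso x φ).hom := by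
  rw [mul_endIso, endComp, MonoidalCategory.tensorHom_def', Category.assoc]

/-- Evaluation of linear forms exhibits `b'` as the tensor product over `b` of the dual of a
compact generator `x` with `x`.  Hom out of `x` turns the coequalizer of `y ⊗ b ⊗ x ⇉ y ⊗ x` that
defines the tensor product, `y` being the dual of `x`, into the coequalizer of `y ⊗ b ⊗ b ⇉ y ⊗ b`,
which is `y` as well, so it makes the evaluation map invertible, and it reflects isomorphisms. -/
theorem nonempty_dual_tensor_iso [HasCoequalizers C] (hx : IsCompactGenerator C x) :
    Nonempty ((dualBimod x φ).tensorBimod (endBimod x φ) ≅ Bimod.regular b') := by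
  let y : C := hom x (regular b')
  let M := dualBimod x φ
  let N := endBimod x φ
  let T : RightMod b' := toRightMod (M.tensorBimod N)
  let π : (tensor y x).X ⟶ T.X := tensorπ M N
  have hπ : π ▷ b'.X ≫ T.act = (tensor y x).act ≫ π :=
    (tensorπ_whiskerRight_actRight M N).trans (Category.assoc _ _ _).symm
  have w : tensorMap (dualActRight x φ) x ≫ π = tensorFold y (endAct x φ) ≫ π :=
    tensorπ_condition M N
  let l : IsColimit (Cofork.ofπ π w) := tensorπIsColimit M N
  let d : (tensor y x).X ⟶ (regular b').X := dualApply x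
  have wd : tensorMap (dualActRight x φ) x ≫ d = tensorFold y (endAct x φ) ≫ d :=
    (dualActRight_apply x φ).trans (Category.assoc _ _ _).symm
  have hd : d ▷ b'.X ≫ (regular b').act = (tensor y x).act ≫ d :=
    (dualApply_linear x).trans (Category.assoc _ _ _).symm
  obtain ⟨ψ, hψ⟩ := Cofork.IsColimit.desc' l d wd
  change π ≫ ψ = d at hψ
  have hψl : ψ ▷ b'.X ≫ (regular b').act = T.act ≫ ψ :=
    linear_of_epi (x := tensor y x) (y := T) (z := regular b') π
      (hq := inferInstanceAs (Epi (tensorπ M N))) ψ hπ hψ hd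
  have := ((isCompactGenerator_iff x).1 hx).2.1
  have := isIso_homStrength hx
  -- `b ≅ Hom(x, x)` and the strength identify `w ⊗ b` with `Hom(x, w ⊗ x)`
  let s : (y ⊗ b.X) ⊗ b.X ⟶ hom x (tensor (y ⊗ b.X) x) :=
    (y ⊗ b.X) ◁ (endIso x φ).hom ≫ homStrength (y ⊗ b.X) x x
  let t : y ⊗ b.X ⟶ hom x (tensor y x) := y ◁ (endIso x φ).hom ≫ homStrength y x x
  have h₁ : dualActRight x φ ▷ b.X ≫ t =
      s ≫ homMap x (tensorMap (dualActRight x φ) x) (tensorMap_linear _ x) := by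
    simp only [s, t, Category.assoc]
    rw [← homStrength_naturality, whisker_exchange_assoc]
  have h₂ : ((α_ _ _ _).hom ≫ y ◁ MonObj.mul) ≫ t =
      s ≫ homMap x (tensorFold y (endAct x φ)) (tensorFold_linear y _ (endAct_linear x φ)) := by
    simp only [s, t, Category.assoc]
    rw [← homStrength_tensorFold y (endAct x φ) (endAct_linear x φ) _ (endComp_apply φ),
      ← MonoidalCategory.whiskerLeft_comp_assoc, ← whiskerLeft_endIso_endComp]
    simp
  obtain ⟨w', ⟨l'⟩⟩ := nonempty_isColimit_homMap (hq := hπ) l s t h₁ h₂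
  -- the action of `b` on the dual of `x` is a coequalizer of the same two maps
  have key : (t ≫ homMap x π hπ) ≫ homMap x ψ hψl = dualActRight x φ := by
    apply hom_ext_apply
    have ht : t ▷ x.X ≫ homApply x (tensor y x) = (α_ _ _ _).hom ≫ y ◁ endAct x φ := by
      have h : (y ◁ (endIso x φ).hom) ▷ x.X ≫ (α_ _ _ _).hom ≫ y ◁ homApply x x =
          (α_ _ _ _).hom ≫ y ◁ endAct x φ := by
        rw [endAct, associator_naturality_middle_assoc, ← MonoidalCategory.whiskerLeft_comp]
      exact (comp_apply _ _ (homStrength_apply y x x)).trans h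
    refine (comp_homMap_apply _ (comp_homMap_apply _ ht _ _) _ _).trans ?_
    refine (Category.assoc _ _ _).trans ((congrArg (_ ≫ ·) hψ).trans ?_)
    exact (Category.assoc _ _ _).trans (dualActRight_apply x φ).symm
  have : IsIso (homMap x ψ hψl) := isIso_of_isColimit_cofork l'
    (actIsColimit (toRightMod (dualBimod x φ))) _ key
  have : IsIso ψ := isIso_of_isIso_homMap hx ψ hψl
  exact ⟨tensorBimodIso M N (K := Bimod.regular b') (dualApply x) (dualActLeft_apply x)
    (dualApply_linear x) ψ hψ this⟩

/-- The tensor product over `b'` of a compact generator `x` with its dual is the monoid `b` of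
endomorphisms of `x`: a pair of an element `s` of `x` and a linear form `ξ` corresponds to the
endomorphism `t ↦ s · ξ t`.  This comes from the coequalizer `x ⊗ b' ⊗ b' ⇉ x ⊗ b' ⟶ x`, which is
preserved by Hom out of `x`. -/
theorem nonempty_tensor_dual_iso [HasCoequalizers C] (hx : IsCompactGenerator C x) :
    Nonempty ((endBimod x φ).tensorBimod (dualBimod x φ) ≅ Bimod.regular b) := by
  let M := endBimod x φ
  let N := dualBimod x φ
  have hm : IsLinearFamily (regular b') (regular b') (MonObj.mul (X := b'.X)) :=
    MonObj.mul_assoc b'.X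
  have hq : x.act ▷ b'.X ≫ x.act = (tensor x.X (regular b')).act ≫ x.act :=
    (by rw [x.act_mul, Iso.hom_inv_id_assoc] :
      x.act ▷ b'.X ≫ x.act = (α_ _ _ _).hom ≫ x.X ◁ MonObj.mul ≫ x.act).trans
      (Category.assoc _ _ _).symm
  have w : tensorMap x.act (regular b') ≫ x.act =
      tensorFold x.X (y := regular b') (y' := regular b') (MonObj.mul (X := b'.X)) ≫ x.act := hq
  let l : IsColimit (Cofork.ofπ (x.act : (tensor x.X (regular b')).X ⟶ x.X) w) := actIsColimit x
  have := ((isCompactGenerator_iff x).1 hx).2.1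
  have := isIso_homStrength hx
  let s := homStrength (x.X ⊗ b'.X) x (regular b')
  let t := homStrength x.X x (regular b')
  have h₁ : x.act ▷ hom x (regular b') ≫ t = s ≫ homMap x (tensorMap x.act (regular b'))
      (tensorMap_linear _ _) := homStrength_naturality _ _ _
  have h₂ : ((α_ _ _ _).hom ≫ x.X ◁ dualActLeft x) ≫ t = s ≫ homMap x
      (tensorFold x.X (y := regular b') (y' := regular b') (MonObj.mul (X := b'.X)))
      (tensorFold_linear _ _ hm) :=
    homStrength_tensorFold _ _ hm _ (dualActLeft_apply x)
  obtain ⟨w', ⟨l'⟩⟩ := nonempty_isColimit_homMap (hq := hq) l s t h₁ h₂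
  -- the pairing of elements and linear forms with values in the endomorphisms of `x`
  let θ : x.X ⊗ hom x (regular b') ⟶ hom x x := t ≫ homMap x x.act hq
  have hθ : θ ▷ x.X ≫ homApply x x = (α_ _ _ _).hom ≫ x.X ◁ dualApply x ≫ x.act :=
    (comp_homMap_apply _ (homStrength_apply x.X x (regular b')) _ _).trans (Category.assoc _ _ _)
  obtain ⟨k, hk⟩ := Cofork.IsColimit.desc' (tensorπIsColimit M N) θ w'
  change tensorπ M N ≫ k = θ at hk
  have : IsIso k := isIso_of_isColimit_cofork (tensorπIsColimit M N) l' k hk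
  -- `θ` is a map of bimodules for the actions of `b` on `Hom(x, x)` through `b ≅ Hom(x, x)`
  have hl : endAct x φ ▷ hom x (regular b') ≫ θ = (α_ _ _ _).hom ≫ b.X ◁ θ ≫ endComp x φ := by
    apply hom_ext_apply
    rw [comp_apply _ _ hθ, comp_whiskerRight, comp_whiskerRight, Category.assoc, Category.assoc,
      endComp_apply, associator_naturality_middle_assoc,
      ← MonoidalCategory.whiskerLeft_comp_assoc, hθ, associator_naturality_left_assoc,
      ← whisker_exchange_assoc, endAct_linear]
    simp
  have hr : θ ▷ b.X ≫ hom x x ◁ (endIso x φ).hom ≫ endMul x =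
      (α_ _ _ _).hom ≫ x.X ◁ dualActRight x φ ≫ θ := by
    apply hom_ext_apply
    simp only [comp_whiskerRight, Category.assoc, endMul_apply, hθ]
    rw [associator_naturality_middle_assoc, ← MonoidalCategory.whiskerLeft_comp_assoc,
      associator_naturality_left_assoc, ← whisker_exchange_assoc, hθ,
      associator_naturality_middle_assoc, ← MonoidalCategory.whiskerLeft_comp_assoc _ (_ ▷ _),
      dualActRight_apply, endAct]
    simp
  have hinv {a : C} (f : a ⟶ hom x x) (g : a ⟶ b.X) (h : f = g ≫ (endIso x φ).hom) :
      f ≫ (endIso x φ).inv = g := by rw [h, Category.assoc, Iso.hom_inv_id, Category.comp_id]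
  refine ⟨tensorBimodIso M N (K := Bimod.regular b) (θ ≫ (endIso x φ).inv) ?_ ?_
    (k ≫ (endIso x φ).inv) ?_ (IsIso.comp_isIso' this (Iso.isIso_inv _))⟩
  · have h : endAct x φ ▷ hom x (regular b') ≫ θ ≫ (endIso x φ).inv =
        (α_ _ _ _).hom ≫ b.X ◁ (θ ≫ (endIso x φ).inv) ≫ MonObj.mul := by
      rw [← Category.assoc]
      apply hinv
      rw [hl]
      simp only [Category.assoc, ← whiskerLeft_endIso_endComp,
        ← MonoidalCategory.whiskerLeft_comp_assoc, Iso.inv_hom_id, Category.comp_id]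
    exact h
  · have h : (θ ≫ (endIso x φ).inv) ▷ b.X ≫ MonObj.mul =
        (α_ _ _ _).hom ≫ x.X ◁ dualActRight x φ ≫ θ ≫ (endIso x φ).inv := by
      rw [← reassoc_of% hr, ← cancel_mono (endIso x φ).hom, Category.assoc, mul_endIso,
        MonoidalCategory.tensorHom_def]
      simp only [Category.assoc, Iso.inv_hom_id, Category.comp_id, ← comp_whiskerRight_assoc]
    exact h
  · exact (Category.assoc _ _ _).symm.trans (congrArg (· ≫ _) hk)

end RightMod

/-! ### Tensoring with an invertible bimodule is an equivalence -/

namespace RightMod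

variable {C : Type u} [Category.{v} C] [MonoidalCategory C] {b b' b'' : Mon C}

/-- A right module as a bimodule, the unit object acting trivially on the left. -/
def asBimod (z : RightMod b) : Bimod (Mon.trivial C) b where
  X := z.X
  actLeft := (λ_ z.X).hom
  one_actLeft := by
    change (𝟙 (𝟙_ C)) ▷ z.X ≫ (λ_ z.X).hom = (λ_ z.X).hom
    simp
  left_assoc := by
    change (λ_ (𝟙_ C)).hom ▷ z.X ≫ (λ_ z.X).hom =
      (α_ (𝟙_ C) (𝟙_ C) z.X).hom ≫ 𝟙_ C ◁ (λ_ z.X).hom ≫ (λ_ z.X).hom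
    monoidal
  actRight := z.act
  actRight_one := z.act_one
  right_assoc := z.act_mul
  middle_assoc := by
    change (λ_ z.X).hom ▷ b.X ≫ z.act = (α_ (𝟙_ C) z.X b.X).hom ≫ 𝟙_ C ◁ z.act ≫ (λ_ z.X).hom
    simp

section

variable [SymmetricCategory C] [MonoidalClosed C] [HasEqualizers C]

theorem precomp_ofLinear_apply {y z : RightMod b} (f : y.X ⟶ z.X)
    (hf : f ▷ b.X ≫ z.act = y.act ≫ f) (w : RightMod b) :
    precomp (V := C) (X := y) (Y := z) (ofLinear f hf) w ▷ y.X ≫ homApply y w =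
      hom z w ◁ f ≫ homApply z w := by
  have key : ((λ_ (hom z w)).inv ≫ element f hf ▷ _ ≫ homComp y z w) ▷ y.X ≫ homApply y w =
      hom z w ◁ f ≫ homApply z w := by
    simp only [comp_whiskerRight, Category.assoc]
    rw [homComp_apply, ← comp_whiskerRight_assoc _ (β_ _ _).hom,
      BraidedCategory.braiding_naturality_left, comp_whiskerRight_assoc,
      associator_naturality_middle_assoc, ← MonoidalCategory.whiskerLeft_comp_assoc, element,
      homCurry_apply, braiding_tensorUnit_left]
    simp
  exact key

theorem postcomp_ofLinear {y z : RightMod b} (f : y.X ⟶ z.X)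
    (hf : f ▷ b.X ≫ z.act = y.act ≫ f) (w : RightMod b) :
    postcomp (V := C) w (ofLinear f hf) = homMap w f hf := by
  refine (homMap_ofElement w (element f hf)).trans (hom_ext_apply ?_)
  rw [homMap_apply, homMap_apply, ofElement_element]

end

variable [SymmetricCategory C] [MonoidalClosed C] [HasCoequalizers C]

/-- The right `b'`-module `z ⊛ x` for a right `b`-module `z` and a `(b, b')`-bimodule `x`. -/
def modTensor (z : RightMod b) (x : Bimod b b') : RightMod b' :=
  toRightMod ((asBimod z).tensorBimod x)

/-- The projection `z ⊗ x ⟶ z ⊛ x`. -/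
def modTensorπ (z : RightMod b) (x : Bimod b b') : z.X ⊗ x.X ⟶ (modTensor z x).X :=
  tensorπ (asBimod z) x

instance (z : RightMod b) (x : Bimod b b') : Epi (modTensorπ z x) :=
  inferInstanceAs (Epi (tensorπ (asBimod z) x))

theorem modTensorπ_condition (z : RightMod b) (x : Bimod b b') :
    z.act ▷ x.X ≫ modTensorπ z x = (α_ _ _ _).hom ≫ z.X ◁ x.actLeft ≫ modTensorπ z x :=
  (tensorπ_condition (asBimod z) x).trans (Category.assoc _ _ _)

theorem modTensorπ_linear (z : RightMod b) (x : Bimod b b') :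
    modTensorπ z x ▷ b'.X ≫ (modTensor z x).act =
      (α_ _ _ _).hom ≫ z.X ◁ x.actRight ≫ modTensorπ z x :=
  tensorπ_whiskerRight_actRight (asBimod z) x

/-- The universal property of `z ⊛ x` with a parameter object `h` on the left, which `h ⊗ -`
preserves as a left adjoint. -/
theorem exists_whiskerLeft_modTensorπ_comp (z : RightMod b) (x : Bimod b b') (h : C) {k : C}
    (f : h ⊗ (z.X ⊗ x.X) ⟶ k)
    (hf : h ◁ (z.act ▷ x.X) ≫ f = h ◁ ((α_ _ _ _).hom ≫ z.X ◁ x.actLeft) ≫ f) :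
    ∃ g : h ⊗ (modTensor z x).X ⟶ k, h ◁ modTensorπ z x ≫ g = f :=
  ⟨Cofork.IsColimit.desc (isColimitOfHasCoequalizerOfPreservesColimit (tensorLeft h)
    (z.act ▷ x.X) ((α_ _ _ _).hom ≫ z.X ◁ x.actLeft)) f hf,
    Cofork.IsColimit.π_desc' (isColimitOfHasCoequalizerOfPreservesColimit (tensorLeft h)
      (z.act ▷ x.X) ((α_ _ _ _).hom ≫ z.X ◁ x.actLeft)) f hf⟩

theorem associatorBimod_hom (P : Bimod b b') {r s : Mon C} (Q : Bimod b' r) (L : Bimod r s) :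
    tensorπ P Q ▷ L.X ≫ tensorπ (P.tensorBimod Q) L ≫ (Bimod.associatorBimod P Q L).hom.hom =
      (α_ _ _ _).hom ≫ P.X ◁ tensorπ Q L ≫ tensorπ P (Q.tensorBimod L) := by
  have h : tensorπ (P.tensorBimod Q) L ≫ (Bimod.associatorBimod P Q L).hom.hom =
      Bimod.AssociatorBimod.homAux P Q L := coequalizer.π_desc _ _
  refine (congrArg (_ ≫ ·) h).trans ?_
  exact π_tensor_id_preserves_coequalizer_inv_desc _ _ _ _

theorem tensorπ_whiskerLeft (P : Bimod b b') {N N' : Bimod b' b''} (f : N ⟶ N') :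
    tensorπ P N ≫ (Bimod.whiskerLeft P f).hom = P.X ◁ f.hom ≫ tensorπ P N' :=
  ι_colimMap _ _

theorem tensorπ_rightUnitor (P : Bimod b b') :
    tensorπ P (Bimod.regular b') ≫ (Bimod.rightUnitorBimod P).hom.hom = P.actRight :=
  coequalizer.π_desc _ _

/-- An isomorphism `x ⊛ y ≅ b` of bimodules induces `(z ⊛ x) ⊛ y ≅ z ⊛ (x ⊛ y) ≅ z ⊛ b ≅ z`.  The
left action of the unit object plays no role in `z ⊛ x`, so `modTensor (modTensor z x) y` is the
right module underlying an iterated tensor product of bimodules, by definition. -/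
theorem exists_modTensor_modTensor_iso {x : Bimod b b'} {y : Bimod b' b}
    (i : x.tensorBimod y ≅ Bimod.regular b) (z : RightMod b) :
    ∃ κ : (modTensor (modTensor z x) y).X ⟶ z.X, IsIso κ ∧
      κ ▷ b.X ≫ z.act = (modTensor (modTensor z x) y).act ≫ κ ∧
      modTensorπ z x ▷ y.X ≫ modTensorπ (modTensor z x) y ≫ κ =
        (α_ _ _ _).hom ≫ z.X ◁ (tensorπ x y ≫ i.hom.hom) ≫ z.act := by
  let P := asBimod z
  let e := Bimod.associatorBimod P x y
  let u := (Bimod.whiskerLeft P i.hom)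
  let r := Bimod.rightUnitorBimod P
  have hu : IsIso u := ⟨Bimod.whiskerLeft P i.inv,
    by rw [← Bimod.whiskerLeft_comp_bimod, Iso.hom_inv_id, Bimod.whiskerLeft_id_bimod],
    by rw [← Bimod.whiskerLeft_comp_bimod, Iso.inv_hom_id, Bimod.whiskerLeft_id_bimod]⟩
  let κ := e.hom ≫ u ≫ r.hom
  have : IsIso κ := inferInstance
  refine ⟨κ.hom, inferInstanceAs (IsIso ((Bimod.forget (A := Mon.trivial C) (B := b)).map κ)),
    κ.right_act_hom.symm, ?_⟩
  have h : tensorπ P x ▷ y.X ≫ tensorπ (P.tensorBimod x) y ≫ e.hom.hom ≫ u.hom ≫ r.hom.hom =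
      (α_ _ _ _).hom ≫ P.X ◁ (tensorπ x y ≫ i.hom.hom) ≫ P.actRight := by
    have h₁ := associatorBimod_hom P x y
    have h₂ := tensorπ_whiskerLeft P i.hom
    have h₃ := tensorπ_rightUnitor P
    have := reassoc_of% h₁
    rw [this, reassoc_of% h₂, h₃, MonoidalCategory.whiskerLeft_comp]
    exact congrArg (_ ≫ ·) (Category.assoc _ _ _).symm
  exact h

variable [HasEqualizers C]

theorem exists_modTensor_apply (z w : RightMod b) (x : Bimod b b') :
    ∃ f : hom z w ⊗ (modTensor z x).X ⟶ (modTensor w x).X,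
      hom z w ◁ modTensorπ z x ≫ f = (α_ _ _ _).inv ≫ homApply z w ▷ x.X ≫ modTensorπ w x := by
  apply exists_whiskerLeft_modTensorπ_comp
  have h := modTensorπ_condition w x
  have h' := homApply_linear z w
  rw [associator_inv_naturality_middle_assoc, ← comp_whiskerRight_assoc,
    ← (Iso.inv_comp_eq _).2 h', comp_whiskerRight_assoc, comp_whiskerRight_assoc, h]
  simp only [MonoidalCategory.whiskerLeft_comp, Category.assoc]
  rw [associator_inv_naturality_right_assoc, whisker_exchange_assoc,
    associator_naturality_left_assoc]
  simp

/-- Application of a morphism `z ⟶ w` to the first factor of `z ⊛ x`. -/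
def modTensorApply (z w : RightMod b) (x : Bimod b b') :
    hom z w ⊗ (modTensor z x).X ⟶ (modTensor w x).X :=
  (exists_modTensor_apply z w x).choose

theorem whiskerLeft_modTensorπ_apply (z w : RightMod b) (x : Bimod b b') :
    hom z w ◁ modTensorπ z x ≫ modTensorApply z w x =
      (α_ _ _ _).inv ≫ homApply z w ▷ x.X ≫ modTensorπ w x :=
  (exists_modTensor_apply z w x).choose_spec

theorem modTensorApply_linear (z w : RightMod b) (x : Bimod b b') :
    IsLinearFamily (modTensor z x) (modTensor w x) (modTensorApply z w x) := by
  rw [IsLinearFamily, ← cancel_epi ((hom z w ◁ modTensorπ z x) ▷ b'.X),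
    ← comp_whiskerRight_assoc, whiskerLeft_modTensorπ_apply]
  have h := modTensorπ_linear w x
  have h' := modTensorπ_linear z x
  simp only [comp_whiskerRight, Category.assoc, h]
  rw [associator_naturality_middle_assoc, ← MonoidalCategory.whiskerLeft_comp_assoc, h']
  simp only [MonoidalCategory.whiskerLeft_comp, Category.assoc, whiskerLeft_modTensorπ_apply]
  rw [associator_naturality_left_assoc, ← whisker_exchange_assoc]
  simp

/-- The action of `- ⊛ x` on Hom objects. -/
def modTensorMap (z w : RightMod b) (x : Bimod b b') :
    hom z w ⟶ hom (modTensor z x) (modTensor w x) :=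
  homCurry (modTensorApply z w x) (modTensorApply_linear z w x)

theorem modTensorMap_apply (z w : RightMod b) (x : Bimod b b') :
    modTensorMap z w x ▷ (modTensor z x).X ≫ homApply _ _ = modTensorApply z w x :=
  homCurry_apply _ _

/-- The enriched functor `- ⊛ x` from right `b`-modules to right `b'`-modules. -/
def modTensorFunctor (x : Bimod b b') : EnrichedFunctor C (RightMod b) (RightMod b') where
  obj z := modTensor z x
  map z w := modTensorMap z w x
  map_id z := by
    change homId z ≫ modTensorMap z z x = homId (modTensor z x)
    apply hom_ext_apply
    rw [comp_whiskerRight, Category.assoc, modTensorMap_apply, homId_apply,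
      ← cancel_epi (_ ◁ modTensorπ z x), whisker_exchange_assoc, whiskerLeft_modTensorπ_apply,
      associator_inv_naturality_left_assoc, ← comp_whiskerRight_assoc, homId_apply]
    simp
  map_comp z w t := by
    change homComp z w t ≫ modTensorMap z t x =
      (modTensorMap z w x ⊗ₘ modTensorMap w t x) ≫ homComp _ _ _
    apply hom_ext_apply
    have key : (modTensorMap w t x ⊗ₘ modTensorMap z w x) ▷ (modTensor z x).X ≫
        (α_ _ _ _).hom ≫ _ ◁ homApply (modTensor z x) (modTensor w x) ≫
          homApply (modTensor w x) (modTensor t x) =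
        (α_ _ _ _).hom ≫ hom w t ◁ modTensorApply z w x ≫ modTensorApply w t x := by
      rw [MonoidalCategory.tensorHom_def', comp_whiskerRight, Category.assoc,
        associator_naturality_left_assoc, ← whisker_exchange_assoc, modTensorMap_apply,
        associator_naturality_middle_assoc, ← MonoidalCategory.whiskerLeft_comp_assoc,
        modTensorMap_apply]
    rw [comp_whiskerRight, Category.assoc, modTensorMap_apply, comp_whiskerRight, Category.assoc,
      homComp_apply, ← comp_whiskerRight_assoc, BraidedCategory.braiding_naturality,
      comp_whiskerRight_assoc, key, ← cancel_epi (_ ◁ modTensorπ z x), whisker_exchange_assoc,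
      whiskerLeft_modTensorπ_apply, associator_inv_naturality_left_assoc,
      ← comp_whiskerRight_assoc, homComp_apply, whisker_exchange_assoc,
      associator_naturality_right_assoc, ← MonoidalCategory.whiskerLeft_comp_assoc,
      whiskerLeft_modTensorπ_apply]
    simp only [comp_whiskerRight, MonoidalCategory.whiskerLeft_comp, Category.assoc,
      whiskerLeft_modTensorπ_apply]
    simp

/-- The composite of the functors `- ⊛ x` and `- ⊛ y` on Hom objects: a morphism is applied to the
first of three factors. -/
theorem modTensorMap_modTensorMap_apply (z w : RightMod b) (x : Bimod b b') (y : Bimod b' b'') :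
    hom z w ◁ (modTensorπ z x ▷ y.X ≫ modTensorπ (modTensor z x) y) ≫
      (modTensorMap z w x ≫ modTensorMap _ _ y) ▷ (modTensor (modTensor z x) y).X ≫
        homApply _ _ =
      hom z w ◁ (α_ _ _ _).hom ≫ (α_ _ _ _).inv ≫ homApply z w ▷ (x.X ⊗ y.X) ≫
        (α_ _ _ _).inv ≫ modTensorπ w x ▷ y.X ≫ modTensorπ (modTensor w x) y := by
  rw [comp_whiskerRight, Category.assoc, modTensorMap_apply, MonoidalCategory.whiskerLeft_comp,
    Category.assoc, whisker_exchange_assoc, whiskerLeft_modTensorπ_apply,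
    associator_inv_naturality_left_assoc, ← comp_whiskerRight_assoc, modTensorMap_apply,
    associator_inv_naturality_middle_assoc, ← comp_whiskerRight_assoc,
    whiskerLeft_modTensorπ_apply]
  simp

/-- The isomorphisms `(z ⊛ x) ⊛ y ≅ z` are enriched natural in `z`: on elements, `s ⊗ t ⊗ u` is sent
to the product of `s` with the image of `t ⊗ u` in `b`, and a linear map commutes with this. -/
theorem nonempty_modTensorFunctor_comp_iso {x : Bimod b b'} {y : Bimod b' b}
    (i : x.tensorBimod y ≅ Bimod.regular b) :
    Nonempty (EnrichedNatIso C ((modTensorFunctor x).comp C (modTensorFunctor y))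
      (EnrichedFunctor.id C (RightMod b))) := by
  choose κ hκ hl h' using exists_modTensor_modTensor_iso i
  obtain ⟨m, h⟩ : ∃ m : x.X ⊗ y.X ⟶ b.X, ∀ z,
      modTensorπ z x ▷ y.X ≫ modTensorπ (modTensor z x) y ≫ κ z =
        (α_ _ _ _).hom ≫ z.X ◁ m ≫ z.act := ⟨_, h'⟩
  have hi (z : RightMod b) : IsIso (ofLinear (κ z) (hl z)) := by
    have : IsIso ((underlying b).map (ofLinear (κ z) (hl z))) := by
      rw [underlying_map_ofLinear]
      exact hκ z
    exact isIso_of_reflects_iso _ (underlying b)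
  have natural (z w : RightMod b) :
      (modTensorMap z w x ≫ modTensorMap _ _ y) ≫ homMap _ (κ w) (hl w) =
        precomp (V := C) (X := modTensor (modTensor z x) y) (Y := z) (ofLinear (κ z) (hl z)) w := by
    apply hom_ext_apply
    rw [precomp_ofLinear_apply, comp_whiskerRight, Category.assoc, homMap_apply,
      ← cancel_epi (hom z w ◁ (modTensorπ z x ▷ y.X ≫ modTensorπ (modTensor z x) y))]
    have e := modTensorMap_modTensorMap_apply z w x y
    rw [reassoc_of% e, h w, ← MonoidalCategory.whiskerLeft_comp_assoc, Category.assoc, h z]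
    simp only [MonoidalCategory.whiskerLeft_comp, Category.assoc]
    rw [Iso.inv_hom_id_assoc, ← whisker_exchange_assoc, homApply_linear]
    simp
  exact ⟨{
    app z := @asIso _ _ _ _ (ofLinear (κ z) (hl z)) (hi z)
    naturality z w := (congrArg (_ ≫ ·) (postcomp_ofLinear (κ w) (hl w) _)).trans
      ((natural z w).trans (Category.id_comp _).symm) }⟩

/-- An invertible bimodule induces an equivalence of enriched categories of right modules. -/
theorem moritaEquivalent_of_bimod {x : Bimod b b'} {y : Bimod b' b}
    (i : x.tensorBimod y ≅ Bimod.regular b) (j : y.tensorBimod x ≅ Bimod.regular b') :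
    MoritaEquivalent b b' :=
  ⟨modTensorFunctor x, modTensorFunctor y, nonempty_modTensorFunctor_comp_iso i,
    nonempty_modTensorFunctor_comp_iso j⟩

end RightMod

end

end EnrichedMorita

/-! ### The equivalence of the three conditions -/

open EnrichedMorita EnrichedMorita.RightMod in
theorem corollary1p4 {C : Type u} [Category.{v} C] [MonoidalCategory C] [SymmetricCategory C]
    [MonoidalClosed C] [HasFiniteLimits C] [HasFiniteColimits C] (b b' : Mon C) :
    List.TFAE [
      EnrichedMorita.MoritaEquivalent b b',
      ∃ x : EnrichedMorita.RightMod b', EnrichedMorita.IsCompactGenerator C x ∧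
        Nonempty (b ≅ EnrichedMorita.endMon C x),
      ∃ (x : Bimod b b') (y : Bimod b' b),
        Nonempty (x.tensorBimod y ≅ Bimod.regular b) ∧
        Nonempty (y.tensorBimod x ≅ Bimod.regular b')] := by
  tfae_have 1 → 2 := by
    rintro ⟨F, G, ⟨η⟩, ⟨ε⟩⟩
    have := isIso_map_of_inverse η ε (regular b) (regular b)
    exact ⟨F.obj (regular b), (isCompactGenerator_regular b).map η ε,
      ⟨endMonRegularIso b ≪≫ endMonIso F (regular b)⟩⟩
  tfae_have 2 → 3 := fun ⟨x, hx, ⟨φ⟩⟩ =>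
    ⟨endBimod x φ, dualBimod x φ, nonempty_tensor_dual_iso φ hx, nonempty_dual_tensor_iso φ hx⟩
  tfae_have 3 → 1 := fun ⟨_, _, ⟨i⟩, ⟨j⟩⟩ => moritaEquivalent_of_bimod i j
  tfae_finish
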